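/- **Setting.** Let $G=(V,E,w)$ be a weighted undirected simple graph on $n\ge 2$ vertices with positive edge weights, let $\mathrm{dist}_X$ be the shortest-path distance in a subgraph $X\subseteq G$ ($\infty$ between different components), and let $W_{\max}(G)$ be the largest edge weight of $G$. *Completion.* Let $P=(x_0,\dots,x_t)$ be a shortest path of $G$ and let $H\subseteq G$. An $\alpha$-segmentation of $P$ with respect to $H$ is a sequence $([i_0,i_1],\dots,[i_{s-1},i_s])$ with $0=i_0<\dots<i_s=t$ such that $\mathrm{dist}_H(x_{i_{j-1}},x_{i_j})\le\alpha\,\mathrm{dist}_G(x_{i_{j-1}},x_{i_j})$ whenever $i_j-i_{j-1}\ge 2$. It is minimal if no two or more consecutive segments can be merged into one to give another $\alpha$-segmentation. Its $\alpha$-distant edges are the edges $e=\{u,v\}$ of $P$ that form a segment by themselves and satisfy $\mathrm{dist}_H(u,v)>\alpha\, w(e)$. The $(\alpha,\beta)$-completion of $H_0$ starts with $H=H_0$. As long as there is a pair $x,y$ with $\mathrm{dist}_H(x,y)>\alpha\,\mathrm{dist}_G(x,y)+\beta W_{\max}(G)$, it picks any such pair, any shortest $x$–$y$ path of $G$ and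 any minimal $\alpha$-segmentation of it, and adds the $\alpha$-distant edges of this segmentation to $H$. *Baswana–Sen spanner.* Put $S_0=V$ and, for $1\le i\le k-1$, let $S_i$ contain each element of $S_{i-1}$ independently with probability $p$. Initially every vertex is a cluster with itself as center, and all edges are remaining. In iteration $i=1,\dots,k-1$ the clusters with center in $S_i$ are the sampled ones. Each vertex $v$ outside the sampled clusters does the following, with respect to the edges remaining at the start of the iteration. If $v$ is adjacent to no sampled cluster, it adds to the spanner a lightest edge to each adjacent cluster, discards all its edges to these clusters, and becomes unclustered. Otherwise it joins a nearest sampled cluster through a lightest edge $e_v$, adds $e_v$ and, for each adjacent cluster to which it has an edge lighter than $e_v$, a lightest edge to that cluster, and discards all its edges to the clusters so treated. Vertices of sampled clusters stay in their clusters, and finally all edges inside a new cluster are discarded. After the last iteration every vertex adds a lightest remaining edge to each adjacent cluster. Ties are broken arbitrarily. **Theorem.** Let $k\ge 1$ be odd with $k=O(\log n)$, and let the sampling probability satisfy $p^k\le \mathrm{polylog}(n)/n$ (for example $p=n^{-1/k}$). Let $H_0$ be the output of the Baswana–Sen algorithm with parameter $k$ on $G$. Then, with high probability, the $(k,k-1)$-completion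 of $H_0$ adds at most $\tilde O(n^{1+1/k})$ edges in total. Precisely: for all real $K,A$ and all integers $a,d\ge 0$ there are a real $C$ and an integer $c\ge 0$ such that for all $n\ge 2$, all odd $k\le K\log n$, all $p\in[0,1]$ with $p^k\le A(\log n)^a/n$ and all weighted graphs $G$ as above on $n$ vertices, with probability at least $1-n^{-d}$ over the choice of the sets $S_i$, the following holds: for every way to break ties in the Baswana–Sen algorithm and every run of the $(k,k-1)$-completion, the total number of edges added during the completion is at most $C(\log n)^c\,n^{1+1/k}$. -/

import Mathlib

open scoped NNReal ENNReal

namespace WeightedSpanner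

/-! ### Weighted graphs

A weighted graph is a simple graph `G` together with a weight function `w : Sym2 V → ℝ≥0`; only the
values of `w` on edges of the graph at hand are ever used. -/

section Graphs

variable {V : Type*}

/-- The weight of a walk: the sum of the weights of its edges. -/
noncomputable def walkWeight (w : Sym2 V → ℝ≥0) {H : SimpleGraph V} {x y : V}
    (p : H.Walk x y) : ℝ≥0 :=
  (p.edges.map w).sum

/-- The weighted shortest-path distance in `H`; it is `∞` between different components. -/
noncomputable def wdist (w : Sym2 V → ℝ≥0) (H : SimpleGraph V) (x y : V) : ℝ≥0∞ :=
  ⨅ p : H.Walk x y, (walkWeight w p : ℝ≥0∞)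

/-- The maximum weight of an edge of `G` (and `0` if `G` has no edge). -/
noncomputable def maxWeight (w : Sym2 V → ℝ≥0) (G : SimpleGraph V) : ℝ≥0∞ :=
  ⨆ e ∈ G.edgeSet, (w e : ℝ≥0∞)

/-- `P` is a shortest path of `G`. -/
def IsShortestPath (w : Sym2 V → ℝ≥0) {G : SimpleGraph V} {x y : V} (P : G.Walk x y) : Prop :=
  P.IsPath ∧ (walkWeight w P : ℝ≥0∞) = wdist w G x y

/-! ### Segmentations

A segmentation `([i₀,i₁], …, [i_{s-1},i_s])` with `0 = i₀ < i₁ < ⋯ < i_s = t` of a path with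
vertices `x₀, …, x_t` is given by the finite set `B = {i₀, …, i_s}` of its breakpoints. -/

/-- `[a, b]` is one of the segments: `a < b` are consecutive breakpoints. -/
def IsSegment (B : Finset ℕ) (a b : ℕ) : Prop :=
  a ∈ B ∧ b ∈ B ∧ a < b ∧ ∀ c ∈ B, ¬ (a < c ∧ c < b)

/-- `B` is an `α`-segmentation of the path `P` of `G` with respect to `H`: every segment with at
least two edges has stretch at most `α` in `H`. -/
def IsSegmentation (w : Sym2 V → ℝ≥0) {G : SimpleGraph V} (H : SimpleGraph V) (α : ℝ≥0)
    {x y : V} (P : G.Walk x y) (B : Finset ℕ) : Prop :=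
  0 ∈ B ∧ P.length ∈ B ∧ (∀ i ∈ B, i ≤ P.length) ∧
    ∀ a b, IsSegment B a b → a + 2 ≤ b →
      wdist w H (P.getVert a) (P.getVert b) ≤ α * wdist w G (P.getVert a) (P.getVert b)

/-- The segmentation obtained by merging all segments between the breakpoints `a` and `b`. -/
def mergeSegments (B : Finset ℕ) (a b : ℕ) : Finset ℕ :=
  B.filter fun c => c ≤ a ∨ b ≤ c

/-- An `α`-segmentation is minimal if no consecutive sequence of (at least two) segments can be
merged to give another `α`-segmentation. -/
def IsMinimalSegmentation (w : Sym2 V → ℝ≥0) {G : SimpleGraph V} (H : SimpleGraph V) (α : ℝ≥0)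
    {x y : V} (P : G.Walk x y) (B : Finset ℕ) : Prop :=
  IsSegmentation w H α P B ∧
    ∀ a ∈ B, ∀ b ∈ B, (∃ c ∈ B, a < c ∧ c < b) → ¬ IsSegmentation w H α P (mergeSegments B a b)

/-- The `α`-distant edges of a segmentation: the edges `e = {u, v}` of `P` that are a segment by
themselves and satisfy `dist_H(u, v) > α · w(e)`. -/
def distantEdges (w : Sym2 V → ℝ≥0) {G : SimpleGraph V} (H : SimpleGraph V) (α : ℝ≥0)
    {x y : V} (P : G.Walk x y) (B : Finset ℕ) : Set (Sym2 V) :=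
  {e | ∃ a, IsSegment B a (a + 1) ∧ e = s(P.getVert a, P.getVert (a + 1)) ∧
    (α * w e : ℝ≥0∞) < wdist w H (P.getVert a) (P.getVert (a + 1))}

/-! ### The greedy completion -/

/-- One iteration of the `(α, β)`-completion for `G`, from the current graph `H` to `H'`: pick
any pair `x, y` with `dist_H(x, y) > α · dist_G(x, y) + β · W_max(G)`, a shortest path `P` of `G`
between them and a minimal `α`-segmentation of `P`, and add its `α`-distant edges. -/
def CompletionStep (w : Sym2 V → ℝ≥0) (G : SimpleGraph V) (α β : ℝ≥0)
    (H H' : SimpleGraph V) : Prop :=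
  ∃ (x y : V) (P : G.Walk x y) (B : Finset ℕ),
    α * wdist w G x y + β * maxWeight w G < wdist w H x y ∧
    IsShortestPath w P ∧
    IsMinimalSegmentation w H α P B ∧
    H' = H ⊔ SimpleGraph.fromEdgeSet (distantEdges w H α P B)

/-- `H` is a state of some run of the `(α, β)`-completion of `H₀` (after any number of
iterations). -/
def CompletionReaches (w : Sym2 V → ℝ≥0) (G : SimpleGraph V) (α β : ℝ≥0) :
    SimpleGraph V → SimpleGraph V → Prop :=
  Relation.ReflTransGen (CompletionStep w G α β)

/-! ### The Baswana–Sen algorithm -/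

/-- The state of the Baswana–Sen algorithm. -/
structure BSState (V : Type*) where
  /-- the center of the cluster that currently contains the vertex, if there is one -/
  center : V → Option V
  /-- the edges that have not been discarded yet -/
  remaining : SimpleGraph V
  /-- the spanner edges chosen so far -/
  spanner : SimpleGraph V

/-- The initial state: every vertex is a cluster of its own, all edges remain, no edge is chosen. -/
def BSState.init (G : SimpleGraph V) : BSState V where
  center := some
  remaining := G
  spanner := ⊥

/-- Some remaining edge joins `v` to the cluster centered at `c`. -/
def BSState.AdjCluster (σ : BSState V) (v c : V) : Prop :=
  ∃ u, σ.remaining.Adj v u ∧ σ.center u = some c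

/-- `pick v c` is the other endpoint of a lightest remaining edge from `v` to the cluster centered
at `c`, whenever `v` is adjacent to this cluster (ties are broken arbitrarily). -/
def BSState.IsLightestPick (w : Sym2 V → ℝ≥0) (σ : BSState V) (pick : V → V → V) : Prop :=
  ∀ v c, σ.AdjCluster v c →
    (σ.remaining.Adj v (pick v c) ∧ σ.center (pick v c) = some c) ∧
    ∀ u, σ.remaining.Adj v u → σ.center u = some c → w s(v, pick v c) ≤ w s(v, u)

/-- `v` belongs to a cluster whose center is in the set `T` of sampled centers. -/
def BSState.InSampled (σ : BSState V) (T : Set V) (v : V) : Prop :=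
  ∃ c ∈ T, σ.center v = some c

/-- `near v` is the sampled cluster nearest to `v` (ties are broken arbitrarily), and `none` if `v`
is adjacent to no sampled cluster. -/
def BSState.IsNearestSampled (w : Sym2 V → ℝ≥0) (σ : BSState V) (T : Set V)
    (pick : V → V → V) (near : V → Option V) : Prop :=
  ∀ v, (near v = none ∧ ∀ c ∈ T, ¬ σ.AdjCluster v c) ∨
    ∃ c₀ ∈ T, near v = some c₀ ∧ σ.AdjCluster v c₀ ∧
      ∀ c ∈ T, σ.AdjCluster v c → w s(v, pick v c₀) ≤ w s(v, pick v c)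

/-- A vertex `v` outside the sampled clusters *selects* the adjacent cluster `c` (that is, it adds a
lightest edge to `c` and discards all its edges to `c`) in the following cases: `v` is adjacent to
no sampled cluster; or `c` is the nearest sampled cluster of `v`; or the lightest edge from `v` to
`c` is lighter than the one to the nearest sampled cluster. -/
def BSState.Selects (w : Sym2 V → ℝ≥0) (σ : BSState V) (T : Set V)
    (pick : V → V → V) (near : V → Option V) (v c : V) : Prop :=
  ¬ σ.InSampled T v ∧ σ.AdjCluster v c ∧
    ∀ c₀, near v = some c₀ → c = c₀ ∨ w s(v, pick v c) < w s(v, pick v c₀)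

/-- One iteration of the clustering phase, with set `T` of sampled centers, from `σ` to `τ`:
1. each vertex outside the sampled clusters adds and discards edges as described above;
2. vertices in sampled clusters stay there, all other vertices join their nearest sampled cluster,
  or become unclustered if they are adjacent to none;
3. edges inside a new cluster are discarded. -/
def BSState.ClusterStep (w : Sym2 V → ℝ≥0) (T : Set V) (σ τ : BSState V) : Prop :=
  ∃ (pick : V → V → V) (near : V → Option V),
    σ.IsLightestPick w pick ∧ σ.IsNearestSampled w T pick near ∧
    τ.spanner = σ.spanner ⊔
      SimpleGraph.fromRel (fun v u => ∃ c, σ.Selects w T pick near v c ∧ pick v c = u) ∧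
    (∀ v, σ.InSampled T v → τ.center v = σ.center v) ∧
    (∀ v, ¬ σ.InSampled T v → τ.center v = near v) ∧
    ∀ u v, τ.remaining.Adj u v ↔ σ.remaining.Adj u v ∧
      ¬ (∃ c, σ.center v = some c ∧ σ.Selects w T pick near u c) ∧
      ¬ (∃ c, σ.center u = some c ∧ σ.Selects w T pick near v c) ∧
      ¬ (∃ c, τ.center u = some c ∧ τ.center v = some c)

/-- The final vertex–cluster joining phase, with output `H`: every vertex adds a lightest remaining
edge to each of its adjacent clusters. -/
def BSState.JoinStep (w : Sym2 V → ℝ≥0) (σ : BSState V) (H : SimpleGraph V) : Prop :=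
  ∃ pick : V → V → V, σ.IsLightestPick w pick ∧
    H = σ.spanner ⊔ SimpleGraph.fromRel (fun v u => ∃ c, σ.AdjCluster v c ∧ pick v c = u)

/-- `H` is a possible output (over all ways to break ties) of the Baswana–Sen algorithm with
parameter `k` on the weighted graph `G`, when the sets of sampled centers are `S 0 ⊇ S 1 ⊇ ⋯`. -/
def IsBaswanaSen (w : Sym2 V → ℝ≥0) (G : SimpleGraph V) (k : ℕ) (S : ℕ → Set V)
    (H : SimpleGraph V) : Prop :=
  ∃ σ : ℕ → BSState V, σ 0 = BSState.init G ∧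
    (∀ i < k - 1, BSState.ClusterStep w (S (i + 1)) (σ i) (σ (i + 1))) ∧
    (σ (k - 1)).JoinStep w H

end Graphs

/-! ### The sampling -/

/-- The sample space of the `k - 1` sampling rounds: one coin for each round and each vertex. -/
abbrev Coins (V : Type*) (k : ℕ) : Type _ := Fin (k - 1) × V → Bool

/-- All coins are independent and show `true` with probability `p`. -/
noncomputable def coinMeasure (V : Type*) [Fintype V] (k : ℕ) (p : unitInterval) :
    MeasureTheory.Measure (Coins V k) :=
  MeasureTheory.Measure.pi fun _ => ProbabilityTheory.bernoulliMeasure true false p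

/-- The set `S i` of level-`i` centers: `S 0 = V`, and `S (i + 1)` keeps each `v ∈ S i` whose coin
in round `i` shows `true`. -/
def centers {V : Type*} {k : ℕ} (ω : Coins V k) : ℕ → Set V
  | 0 => Set.univ
  | i + 1 => {v ∈ centers ω i | ∀ h : i < k - 1, ω (⟨i, h⟩, v) = true}

end WeightedSpanner

open WeightedSpanner

namespace WeightedSpanner

/-! ### Weighted distances -/

section Distances

variable {V : Type*} {w : Sym2 V → ℝ≥0} {G H H' : SimpleGraph V}

/-! Write k = 2m + 1 and W for the largest weight. After i Baswana–Sen iterations, a discarded edge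
has stretch at most 2i, and each endpoint of a surviving edge e is within i · w(e) of its cluster
center (`BSState.Invariant.step`). Hence H₀ has stretch 4m + 1, and an edge of stretch more than k
survives m iterations, so both its endpoints are within m · w(e) of centers in S_m
(`IsBaswanaSen.isClusteredSpanner`).

Consider a completion step with q distant edges. By minimality, a subpath between breakpoints that
starts or ends with a distant edge has stretch more than k. Together with the closeness to centers,
this keeps vertices on the path from sharing a center too often, and at least q/7 distinct pairs of
centers arise from subpaths whose H-distance exceeds k times their length by at least mW
(`exists_label_pairs`). Let such a subpath end at vertices at distance at most m·r and m·s from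
their centers, where its first and last distant edges have lengths at least r and s. Adding the
distant edges brings its distance down to k times its length minus 2m(r + s). Passing to the centers
costs m(r + s) before and again after the step, exactly what was gained, so the distance of the
centers drops by at least mW.

The distance of a pair of centers, truncated to a window of length (8m + 7)mW around k times its
distance in G, never increases, and the window contains every drop used above. So at most 7(8m +
7)|S_m|² edges are ever added (`CompletionStep.totalPotential_drop`, `CompletionReaches.ncard_le`).
With high probability |S_m| is at most a constant times n·p^m, up to a logarithmic term
(`coinMeasure_card_centers_le`), and n²p^(2m) is at most n^(1+1/k) up to polylogarithmic factors
(`sq_mul_pow_le`). -/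

lemma walkWeight_nil (x : V) : walkWeight w (SimpleGraph.Walk.nil : H.Walk x x) = 0 := by
  simp [walkWeight]

lemma walkWeight_cons {x y z : V} (h : H.Adj x y) (p : H.Walk y z) :
    walkWeight w (p.cons h) = w s(x, y) + walkWeight w p := by
  simp [walkWeight]

lemma wdist_le_walkWeight {x y : V} (p : H.Walk x y) : wdist w H x y ≤ walkWeight w p :=
  iInf_le _ p

lemma wdist_self (x : V) : wdist w H x x = 0 := by
  have := wdist_le_walkWeight (w := w) (SimpleGraph.Walk.nil : H.Walk x x)
  simpa [walkWeight_nil] using this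

lemma wdist_le_of_adj {x y : V} (h : H.Adj x y) : wdist w H x y ≤ w s(x, y) := by
  have := wdist_le_walkWeight (w := w) h.toWalk
  simpa [SimpleGraph.Adj.toWalk, walkWeight_cons, walkWeight_nil] using this

lemma wdist_comm (x y : V) : wdist w H x y = wdist w H y x := by
  suffices h : ∀ x y, wdist w H x y ≤ wdist w H y x from le_antisymm (h x y) (h y x)
  intro x y
  refine le_iInf fun p => (wdist_le_walkWeight p.reverse).trans (le_of_eq ?_)
  simp [walkWeight, List.sum_reverse]

lemma wdist_triangle (x y z : V) : wdist w H x z ≤ wdist w H x y + wdist w H y z := by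
  rw [wdist, wdist, wdist, ENNReal.iInf_add]
  refine le_iInf fun p => ?_
  rw [ENNReal.add_iInf]
  refine le_iInf fun q => (wdist_le_walkWeight (p.append q)).trans (le_of_eq ?_)
  simp [walkWeight]

lemma wdist_anti (h : H ≤ H') (x y : V) : wdist w H' x y ≤ wdist w H x y := by
  refine le_iInf fun p => (wdist_le_walkWeight (p.mapLe h)).trans (le_of_eq ?_)
  simp [walkWeight]

lemma wdist_ne_top_iff {x y : V} : wdist w H x y ≠ ⊤ ↔ H.Reachable x y := by
  constructor
  · intro h
    by_contra hn
    apply h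
    have : IsEmpty (H.Walk x y) := ⟨fun p => hn ⟨p⟩⟩
    simp [wdist]
  · rintro ⟨p⟩
    exact ne_top_of_le_ne_top ENNReal.coe_ne_top (wdist_le_walkWeight p)

/-- The weighted distance as a real number. -/
noncomputable def rdist (w : Sym2 V → ℝ≥0) (H : SimpleGraph V) (x y : V) : ℝ :=
  (wdist w H x y).toReal

lemma ofReal_rdist {x y : V} (h : H.Reachable x y) :
    ENNReal.ofReal (rdist w H x y) = wdist w H x y :=
  ENNReal.ofReal_toReal (wdist_ne_top_iff.2 h)

lemma rdist_nonneg (x y : V) : 0 ≤ rdist w H x y := ENNReal.toReal_nonneg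

lemma rdist_self (x : V) : rdist w H x x = 0 := by simp [rdist, wdist_self]

lemma rdist_comm (x y : V) : rdist w H x y = rdist w H y x := by
  rw [rdist, wdist_comm, rdist]

/-- An infinite distance becomes 0 under `toReal`, so the inequality can fail without reachability.
-/
lemma rdist_triangle {x y z : V} (hxy : H.Reachable x y) (hyz : H.Reachable y z) :
    rdist w H x z ≤ rdist w H x y + rdist w H y z := by
  have h1 := wdist_ne_top_iff (w := w).2 hxy
  have h2 := wdist_ne_top_iff (w := w).2 hyz
  rw [rdist, rdist, rdist, ← ENNReal.toReal_add h1 h2]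
  exact ENNReal.toReal_mono (ENNReal.add_ne_top.2 ⟨h1, h2⟩) (wdist_triangle x y z)

lemma rdist_anti (h : H ≤ H') {x y : V} (hxy : H.Reachable x y) :
    rdist w H' x y ≤ rdist w H x y :=
  ENNReal.toReal_mono (wdist_ne_top_iff.2 hxy) (wdist_anti h x y)

lemma rdist_le_of_wdist_le {x y : V} {r : ℝ≥0} (h : wdist w H x y ≤ r) : rdist w H x y ≤ r := by
  simpa [rdist] using ENNReal.toReal_mono ENNReal.coe_ne_top h

lemma reachable_of_wdist_le {x y : V} {r : ℝ≥0} (h : wdist w H x y ≤ r) : H.Reachable x y :=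
  wdist_ne_top_iff.1 (ne_top_of_le_ne_top ENNReal.coe_ne_top h)

lemma rdist_le_of_adj {x y : V} (h : H.Adj x y) : rdist w H x y ≤ w s(x, y) :=
  rdist_le_of_wdist_le (wdist_le_of_adj h)

lemma reachable_mono_of_adj (h : ∀ u v, G.Adj u v → H.Reachable u v) {x y : V}
    (hxy : G.Reachable x y) : H.Reachable x y := by
  obtain ⟨p⟩ := hxy
  induction p with
  | nil => exact SimpleGraph.Reachable.refl _
  | cons hadj _ ih => exact (h _ _ hadj).trans ih

/-- The position of the `i`-th vertex along a walk: the weight of the first `i` edges. -/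
noncomputable def position (w : Sym2 V → ℝ≥0) {x y : V} (P : G.Walk x y) (i : ℕ) : ℝ :=
  ∑ r ∈ Finset.range i, (w s(P.getVert r, P.getVert (r + 1)) : ℝ)

lemma position_zero {x y : V} (P : G.Walk x y) : position w P 0 = 0 := by simp [position]

lemma position_succ {x y : V} (P : G.Walk x y) (i : ℕ) :
    position w P (i + 1) = position w P i + w s(P.getVert i, P.getVert (i + 1)) := by
  simp [position, Finset.sum_range_succ]

lemma position_mono {x y : V} (P : G.Walk x y) : Monotone (position w P) :=
  monotone_nat_of_le_succ fun i => by rw [position_succ]; simp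

lemma walkWeight_eq_position {x y : V} (P : G.Walk x y) :
    (walkWeight w P : ℝ) = position w P P.length := by
  induction P with
  | nil => simp [walkWeight_nil, position]
  | cons h p ih =>
    rw [walkWeight_cons, position, SimpleGraph.Walk.length_cons, Finset.sum_range_succ']
    simp only [SimpleGraph.Walk.getVert_cons_succ]
    push_cast
    rw [ih, position]
    simp [add_comm]

lemma reachable_getVert {x y : V} (P : G.Walk x y) (i : ℕ) : G.Reachable x (P.getVert i) :=
  (P.take i).reachable

lemma reachable_getVert_getVert {x y : V} (P : G.Walk x y) (i j : ℕ) :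
    G.Reachable (P.getVert i) (P.getVert j) :=
  (reachable_getVert P i).symm.trans (reachable_getVert P j)

lemma rdist_getVert_le {x y : V} (P : G.Walk x y) {i j : ℕ} (hij : i ≤ j) (hj : j ≤ P.length) :
    rdist w G (P.getVert i) (P.getVert j) ≤ position w P j - position w P i := by
  induction j, hij using Nat.le_induction with
  | base => simp [rdist_self]
  | succ j hij ih =>
    have h1 := ih (by omega)
    have h2 := rdist_triangle (w := w) (reachable_getVert_getVert P i j)
      (reachable_getVert_getVert P j (j + 1))
    have h3 := rdist_le_of_adj (w := w) (P.adj_getVert_succ (i := j) (by omega))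
    rw [position_succ]
    linarith

lemma IsShortestPath.rdist_eq {x y : V} {P : G.Walk x y} (hP : IsShortestPath w P) :
    rdist w G x y = position w P P.length := by
  rw [← walkWeight_eq_position, rdist, ← hP.2]
  simp

/-- Subpaths of shortest paths are shortest. -/
lemma IsShortestPath.rdist_getVert {x y : V} {P : G.Walk x y} (hP : IsShortestPath w P) {i j : ℕ}
    (hij : i ≤ j) (hj : j ≤ P.length) :
    rdist w G (P.getVert i) (P.getVert j) = position w P j - position w P i := by
  refine le_antisymm (rdist_getVert_le P hij hj) ?_
  -- The three pieces of the path are at most as long as their edges add up to, and together they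
  -- cannot beat the shortest path.
  have h1 := hP.rdist_eq
  have h2 := rdist_getVert_le (w := w) P (Nat.zero_le i) (hij.trans hj)
  have h3 := rdist_getVert_le (w := w) P hj le_rfl
  have h4 := rdist_triangle (w := w) (reachable_getVert_getVert P 0 i)
    (reachable_getVert_getVert P i P.length)
  have h5 := rdist_triangle (w := w) (reachable_getVert_getVert P i j)
    (reachable_getVert_getVert P j P.length)
  simp only [SimpleGraph.Walk.getVert_zero, SimpleGraph.Walk.getVert_length, position_zero] at *
  linarith

lemma le_maxWeight {e : Sym2 V} (he : e ∈ G.edgeSet) : (w e : ℝ≥0∞) ≤ maxWeight w G :=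
  le_iSup₂ (f := fun e (_ : e ∈ G.edgeSet) => (w e : ℝ≥0∞)) e he

lemma maxWeight_ne_top [Finite V] : maxWeight w G ≠ ⊤ := by
  obtain ⟨b, hb⟩ := (Set.finite_range w).bddAbove
  refine ne_top_of_le_ne_top (ENNReal.coe_ne_top (r := b)) (iSup₂_le fun e _ => ?_)
  exact_mod_cast hb ⟨e, rfl⟩

lemma le_toReal_maxWeight [Finite V] {e : Sym2 V} (he : e ∈ G.edgeSet) :
    (w e : ℝ) ≤ (maxWeight w G).toReal := by
  simpa using ENNReal.toReal_mono maxWeight_ne_top (le_maxWeight (w := w) he)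

end Distances

/-! ### Invariants of the Baswana–Sen algorithm -/

section BaswanaSen

variable {V : Type*} {w : Sym2 V → ℝ≥0} {G : SimpleGraph V}

/-- The invariants of the clustering phase after `i` iterations, with centers in `T`. -/
structure BSState.Invariant (w : Sym2 V → ℝ≥0) (G : SimpleGraph V) (T : Set V) (i : ℕ)
    (σ : BSState V) : Prop where
  remaining_le : σ.remaining ≤ G
  spanner_le : σ.spanner ≤ G
  clustered : ∀ u v, σ.remaining.Adj u v → ∃ c, σ.center u = some c
  radius : ∀ u v c, σ.remaining.Adj u v → σ.center u = some c →
    wdist w σ.spanner c u ≤ (i : ℝ≥0∞) * w s(u, v)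
  stretch : ∀ u v, G.Adj u v → ¬ σ.remaining.Adj u v →
    wdist w σ.spanner u v ≤ 2 * (i : ℝ≥0∞) * w s(u, v)
  center_mem : ∀ u c, σ.center u = some c → c ∈ T

lemma BSState.Invariant.init : (BSState.init G).Invariant w G Set.univ 0 where
  remaining_le := le_rfl
  spanner_le := bot_le
  clustered u v _ := ⟨u, rfl⟩
  radius u v c _ h := by
    obtain rfl : u = c := by simpa [BSState.init] using h
    simp [wdist_self]
  stretch u v h h' := absurd h h'
  center_mem _ _ _ := Set.mem_univ _

/-- A lightest edge to the adjacent cluster of `v` gives a short detour for the edge `uv`. -/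
lemma BSState.Invariant.wdist_pick_le {T : Set V} {i : ℕ} {σ : BSState V}
    (hσ : σ.Invariant w G T i) {pick : V → V → V} (hp : σ.IsLightestPick w pick)
    {H : SimpleGraph V} (hH : σ.spanner ≤ H) {u v c : V} (huv : σ.remaining.Adj u v)
    (hc : σ.center v = some c) (hadj : H.Adj u (pick u c)) :
    wdist w H u v ≤ (2 * (i : ℝ≥0∞) + 1) * w s(u, v) := by
  obtain ⟨⟨h1, h2⟩, h3⟩ := hp u c ⟨v, huv, hc⟩
  have h4 : (w s(u, pick u c) : ℝ≥0∞) ≤ w s(u, v) := by exact_mod_cast h3 v huv hc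
  have h5 := (wdist_anti (w := w) hH _ _).trans (hσ.radius _ _ _ h1.symm h2)
  have h6 := (wdist_anti (w := w) hH _ _).trans (hσ.radius _ _ _ huv.symm hc)
  rw [Sym2.eq_swap] at h5 h6
  calc wdist w H u v ≤ wdist w H u (pick u c) + (wdist w H (pick u c) c + wdist w H c v) :=
        (wdist_triangle _ _ _).trans (by gcongr; exact wdist_triangle _ _ _)
    _ ≤ w s(u, v) + ((i : ℝ≥0∞) * w s(u, v) + (i : ℝ≥0∞) * w s(u, v)) := by
        rw [wdist_comm (pick u c) c]
        refine add_le_add ((wdist_le_of_adj hadj).trans h4) (add_le_add (h5.trans ?_) h6)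
        gcongr
    _ = _ := by ring

/-- Radius: a vertex that joins a cluster uses an edge no heavier than any of its edges it did not
discard by a selection, so the radius grows by one such edge. Stretch: an edge discarded by a
selection has a detour through the selected cluster, of stretch 2i + 1; an edge inside a new cluster
has one through the new center, of stretch 2(i + 1). -/
lemma BSState.Invariant.step {T T' : Set V} {i : ℕ} {σ τ : BSState V}
    (hσ : σ.Invariant w G T i) (hstep : σ.ClusterStep w T' τ) :
    τ.Invariant w G T' (i + 1) ∧ σ.spanner ≤ τ.spanner := by
  obtain ⟨pick, near, hp, hn, hspan, hin, hout, hrem⟩ := hstep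
  have hle : σ.spanner ≤ τ.spanner := hspan ▸ le_sup_left
  have hsel : ∀ v c, σ.Selects w T' pick near v c → τ.spanner.Adj v (pick v c) := by
    intro v c h
    rw [hspan, SimpleGraph.sup_adj, SimpleGraph.fromRel_adj]
    exact Or.inr ⟨((hp v c h.2.1).1.1).ne, Or.inl ⟨c, h, rfl⟩⟩
  have hnear : ∀ v c, near v = some c → c ∈ T' ∧ σ.AdjCluster v c := by
    intro v c h
    rcases hn v with ⟨h1, -⟩ | ⟨c₀, h1, h2, h3, -⟩
    · simp [h1] at h
    · obtain rfl : c₀ = c := by simpa [h2] using h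
      exact ⟨h1, h3⟩
  -- edges that are not discarded by a selection are heavy compared to the new radius
  have hrad : ∀ u v c, σ.remaining.Adj u v →
      ¬ (∃ c, σ.center v = some c ∧ σ.Selects w T' pick near u c) → τ.center u = some c →
      wdist w τ.spanner c u ≤ ((i + 1 : ℕ) : ℝ≥0∞) * w s(u, v) := by
    intro u v c huv hns hc
    by_cases hs : σ.InSampled T' u
    · rw [hin u hs] at hc
      refine (wdist_anti hle _ _).trans ((hσ.radius u v c huv hc).trans ?_)
      gcongr
      omega
    · rw [hout u hs] at hc
      have hadj := (hnear u c hc).2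
      obtain ⟨⟨h1, h2⟩, -⟩ := hp u c hadj
      obtain ⟨c', hc'⟩ := hσ.clustered v u huv.symm
      have hadj' : σ.AdjCluster u c' := ⟨v, huv, hc'⟩
      have hw : w s(u, pick u c) ≤ w s(u, v) := by
        have h3 := (hp u c' hadj').2 v huv hc'
        by_contra hlt
        refine hns ⟨c', hc', hs, hadj', fun c₀ h₀ => Or.inr ?_⟩
        obtain rfl : c = c₀ := by simpa [hc] using h₀
        exact h3.trans_lt (not_le.1 hlt)
      have h4 : τ.spanner.Adj u (pick u c) :=
        hsel u c ⟨hs, hadj, fun c₀ h₀ => Or.inl (by simpa [hc] using h₀)⟩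
      have h5 := (wdist_anti (w := w) hle _ _).trans (hσ.radius _ _ _ h1.symm h2)
      rw [Sym2.eq_swap] at h5
      calc wdist w τ.spanner c u
          ≤ wdist w τ.spanner c (pick u c) + wdist w τ.spanner (pick u c) u := wdist_triangle _ _ _
        _ ≤ (i : ℝ≥0∞) * w s(u, pick u c) + w s(u, pick u c) := by
            refine add_le_add h5 ?_
            rw [wdist_comm]
            exact wdist_le_of_adj h4
        _ = ((i + 1 : ℕ) : ℝ≥0∞) * w s(u, pick u c) := by push_cast; ring
        _ ≤ _ := by gcongr
  refine ⟨⟨fun u v h => hσ.remaining_le ((hrem u v).1 h).1, ?_, ?_, ?_, ?_, ?_⟩, hle⟩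
  · rw [hspan]
    refine sup_le hσ.spanner_le ?_
    intro u v h
    rw [SimpleGraph.fromRel_adj] at h
    rcases h with ⟨-, ⟨c, h, rfl⟩ | ⟨c, h, rfl⟩⟩
    · exact hσ.remaining_le (hp _ _ h.2.1).1.1
    · exact (hσ.remaining_le (hp _ _ h.2.1).1.1).symm
  · intro u v h
    obtain ⟨h1, h2, -, -⟩ := (hrem u v).1 h
    by_cases hs : σ.InSampled T' u
    · obtain ⟨c, -, hc⟩ := id hs
      exact ⟨c, by rw [hin u hs, hc]⟩
    · rw [hout u hs]
      rcases hn u with ⟨h3, -⟩ | ⟨c₀, -, h3, -⟩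
      · obtain ⟨c, hc⟩ := hσ.clustered v u h1.symm
        exact absurd ⟨c, hc, hs, ⟨v, h1, hc⟩, fun c₀ h₀ => by simp [h3] at h₀⟩ h2
      · exact ⟨c₀, h3⟩
  · intro u v c h hc
    obtain ⟨h1, h2, -, -⟩ := (hrem u v).1 h
    exact hrad u v c h1 h2 hc
  · intro u v huv hnot
    by_cases hr : σ.remaining.Adj u v
    · have hle' : (2 * (i : ℝ≥0∞) + 1) * w s(u, v) ≤ 2 * ((i + 1 : ℕ) : ℝ≥0∞) * w s(u, v) := by
        gcongr
        push_cast
        rw [mul_add]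
        gcongr
        norm_num
      by_cases h1 : ∃ c, σ.center v = some c ∧ σ.Selects w T' pick near u c
      · obtain ⟨c, hc, hs⟩ := h1
        exact (hσ.wdist_pick_le hp hle hr hc (hsel u c hs)).trans hle'
      by_cases h2 : ∃ c, σ.center u = some c ∧ σ.Selects w T' pick near v c
      · obtain ⟨c, hc, hs⟩ := h2
        rw [wdist_comm]
        rw [Sym2.eq_swap] at hle' ⊢
        exact (hσ.wdist_pick_le hp hle hr.symm hc (hsel v c hs)).trans hle'
      · have h3 : ∃ c, τ.center u = some c ∧ τ.center v = some c := by
          by_contra h3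
          exact hnot ((hrem u v).2 ⟨hr, h1, h2, h3⟩)
        obtain ⟨c, hcu, hcv⟩ := h3
        have h4 := hrad u v c hr h1 hcu
        have h5 := hrad v u c hr.symm h2 hcv
        rw [Sym2.eq_swap] at h5
        rw [wdist_comm] at h4
        refine (wdist_triangle u c v).trans ((add_le_add h4 h5).trans (le_of_eq ?_))
        ring
    · refine (wdist_anti hle _ _).trans ((hσ.stretch u v huv hr).trans ?_)
      gcongr
      omega
  · intro u c hc
    by_cases hs : σ.InSampled T' u
    · obtain ⟨c', hc', h⟩ := id hs
      rw [hin u hs, h] at hc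
      obtain rfl : c' = c := by simpa using hc
      exact hc'
    · rw [hout u hs] at hc
      exact (hnear u c hc).1

/-- What the completion needs to know about the Baswana–Sen spanner `H₀` with parameter
`2 * m + 1`: it has stretch `4 * m + 1`, and both endpoints of an edge of stretch more than
`2 * m + 1` are close to one of the centers in `S`. -/
structure IsClusteredSpanner (w : Sym2 V → ℝ≥0) (G : SimpleGraph V) (m : ℕ) (S : Set V)
    (ctr : V → V) (H₀ : SimpleGraph V) : Prop where
  le : H₀ ≤ G
  stretch : ∀ u v, G.Adj u v → wdist w H₀ u v ≤ ((4 * m + 1 : ℕ) : ℝ≥0∞) * w s(u, v)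
  center : ∀ u v, G.Adj u v → ((2 * m + 1 : ℕ) : ℝ≥0∞) * w s(u, v) < wdist w H₀ u v →
    ctr u ∈ S ∧ wdist w H₀ (ctr u) u ≤ (m : ℝ≥0∞) * w s(u, v)

lemma IsBaswanaSen.isClusteredSpanner {m : ℕ} {S : ℕ → Set V} (hS : S 0 = Set.univ)
    {H₀ : SimpleGraph V} (h : IsBaswanaSen w G (2 * m + 1) S H₀) :
    ∃ ctr, IsClusteredSpanner w G m (S m) ctr H₀ := by
  obtain ⟨σ, h0, hstep, pick, hp, hH⟩ := h
  rw [Nat.add_sub_cancel] at *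
  have hinv : ∀ i ≤ 2 * m, (σ i).Invariant w G (S i) i := by
    intro i
    induction i with
    | zero => intro _; rw [h0, hS]; exact BSState.Invariant.init
    | succ i ih => intro hi; exact ((ih (by omega)).step (hstep i (by omega))).1
  have hmono : ∀ i j, i ≤ j → j ≤ 2 * m → (σ i).spanner ≤ (σ j).spanner := by
    intro i j hij
    induction j, hij using Nat.le_induction with
    | base => intro _; exact le_rfl
    | succ j hij ih =>
      intro hj
      exact (ih (by omega)).trans ((hinv j (by omega)).step (hstep j (by omega))).2
  have hlast := hinv (2 * m) le_rfl
  have hmid := hinv m (by omega)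
  have hle : (σ (2 * m)).spanner ≤ H₀ := hH ▸ le_sup_left
  have hle' : (σ m).spanner ≤ H₀ := (hmono _ _ (by omega) le_rfl).trans hle
  -- The default value for unclustered vertices plays no role: the center is only queried at
  -- endpoints of edges that survive m iterations.
  refine ⟨fun u => ((σ m).center u).getD u, ?_, ?_, ?_⟩
  · rw [hH]
    refine sup_le hlast.spanner_le ?_
    intro u v h
    rw [SimpleGraph.fromRel_adj] at h
    rcases h with ⟨-, ⟨c, h, rfl⟩ | ⟨c, h, rfl⟩⟩
    · exact hlast.remaining_le (hp _ _ h).1.1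
    · exact (hlast.remaining_le (hp _ _ h).1.1).symm
  · intro u v huv
    by_cases hr : (σ (2 * m)).remaining.Adj u v
    · obtain ⟨c, hc⟩ := hlast.clustered v u hr.symm
      have hadj : (σ (2 * m)).AdjCluster u c := ⟨v, hr, hc⟩
      have : H₀.Adj u (pick u c) := by
        rw [hH, SimpleGraph.sup_adj, SimpleGraph.fromRel_adj]
        exact Or.inr ⟨((hp u c hadj).1.1).ne, Or.inl ⟨c, hadj, rfl⟩⟩
      refine (hlast.wdist_pick_le hp hle hr hc this).trans (le_of_eq ?_)
      push_cast; ring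
    · refine (wdist_anti hle _ _).trans ((hlast.stretch u v huv hr).trans ?_)
      gcongr
      norm_cast
      omega
  · intro u v huv hlt
    -- A discarded edge would already have stretch at most 2m.
    have hr : (σ m).remaining.Adj u v := by
      by_contra hr
      refine absurd ((wdist_anti hle' _ _).trans (hmid.stretch u v huv hr)) (not_le.2 ?_)
      refine lt_of_le_of_lt ?_ hlt
      gcongr
      norm_cast
      omega
    obtain ⟨c, hc⟩ := hmid.clustered u v hr
    simp only [hc, Option.getD_some]
    exact ⟨hmid.center_mem u c hc, (wdist_anti hle' _ _).trans (hmid.radius u v c hr hc)⟩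

end BaswanaSen

/-! ### Many distinct pairs of clusters along a path -/

section Pairs

variable {V : Type*}

/-- The index `a` is an endpoint of the `j`-th distant edge, for some `j < q`, which has length
`r`. -/
def IsEndpoint (q : ℕ) (e : ℕ → ℕ) (pos : ℕ → ℝ) (a : ℕ) (r : ℝ) : Prop :=
  ∃ j < q, (a = e j ∨ a = e j + 1) ∧ r = pos (e j + 1) - pos (e j)

/-- Along a path with `q` distant edges at the indices `e 0 < ⋯ < e (q - 1)`, whose endpoints are
labelled by `κ`, at least `q / 7` distinct pairs of labels belong to subpaths of large excess. -/
lemma exists_label_pairs {m W : ℝ} (hm : 0 ≤ m) (hW : 0 ≤ W) {q : ℕ} (hq : 2 ≤ q) {e : ℕ → ℕ}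
    (he : ∀ i j, i < j → j < q → e i < e j) {pos : ℕ → ℝ} (hpos : Monotone pos)
    {d : ℕ → ℕ → ℝ} (htri : ∀ a b c, d a c ≤ d a b + d b c) {κ : ℕ → V}
    (hκ : ∀ a b r s, IsEndpoint q e pos a r → IsEndpoint q e pos b s → κ a = κ b →
      d a b ≤ m * (r + s))
    (hleft : ∀ i j, i < j → j < q → (2 * m + 1) * (pos (e j) - pos (e i)) < d (e i) (e j))
    (hright : ∀ i j, i < j → j < q →
      (2 * m + 1) * (pos (e j + 1) - pos (e i + 1)) < d (e i + 1) (e j + 1))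
    (htotal : (2 * m + 1) * (pos (e (q - 1) + 1) - pos (e 0)) + 2 * m * W
      ≤ d (e 0) (e (q - 1) + 1)) :
    ∃ L : Finset (V × V), q ≤ 7 * L.card ∧ ∀ x ∈ L, ∃ a b i j r s, x = (κ a, κ b) ∧ i < j ∧ j < q ∧
      a ≤ e i ∧ e j < b ∧ IsEndpoint q e pos a r ∧ IsEndpoint q e pos b s ∧
      r ≤ pos (e i + 1) - pos (e i) ∧ s ≤ pos (e j + 1) - pos (e j) ∧
      (2 * m + 1) * (pos b - pos a) + m * W ≤ d a b := by
  classical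
  set ω : ℕ → ℝ := fun j => pos (e j + 1) - pos (e j) with hω
  have hω0 : ∀ j, 0 ≤ ω j := fun j => sub_nonneg.2 (hpos (Nat.le_succ _))
  -- The gap before distant edge j is cut at the inner endpoint of the shorter of its two
  -- neighbouring distant edges. The edge belonging to the cut vertex is then no longer than the
  -- last distant edge on the left and the first one on the right.
  set y : ℕ → ℕ := fun j => if ω j ≤ ω (j - 1) then e j else e (j - 1) + 1 with hy
  have hyA : ∀ j, ω j ≤ ω (j - 1) → y j = e j := fun j h => if_pos h
  have hyB : ∀ j, ¬ ω j ≤ ω (j - 1) → y j = e (j - 1) + 1 := fun j h => if_neg h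
  -- within one type, the labels of the separating vertices are distinct
  have hdistA : ∀ i j, i < j → j < q → ω j ≤ ω (j - 1) → κ (e i) ≠ κ (e j) := by
    intro i j hij hj hle heq
    have h1 := hκ (e i) (e j) (ω i) (ω j) ⟨i, by omega, Or.inl rfl, rfl⟩
      ⟨j, hj, Or.inl rfl, rfl⟩ heq
    have h2 := hleft i j hij hj
    have h3 : ω (j - 1) ≤ pos (e j) - pos (e i) ∧ ω i ≤ pos (e j) - pos (e i) ∧
        (i ≠ j - 1 → ω i + ω (j - 1) ≤ pos (e j) - pos (e i)) := by
      have h4 : pos (e (j - 1) + 1) ≤ pos (e j) := hpos (he (j - 1) j (by omega) hj)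
      have h5 : pos (e i + 1) ≤ pos (e j) := hpos (he i j hij hj)
      have h6 : pos (e i) ≤ pos (e (j - 1)) := by
        rcases Nat.eq_or_lt_of_le (Nat.le_sub_one_of_lt hij) with h | h
        · rw [← h]
        · exact hpos (he i (j - 1) h (by omega)).le
      refine ⟨by simp only [hω]; linarith, by simp only [hω]; linarith, fun hne => ?_⟩
      have h7 : pos (e i + 1) ≤ pos (e (j - 1)) := hpos (he i (j - 1) (by omega) (by omega))
      simp only [hω]; linarith
    obtain ⟨h4, h5, h6⟩ := h3
    have hi := hω0 i
    have hj' := hω0 (j - 1)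
    -- The type of the gap bounds `ω j` by `ω (j - 1)`, the length of an edge between the two
    -- vertices. A common label would thus give a distance of at most 2m times their separation,
    -- against the stretch bound `hleft`.
    have hij' : ω i + ω j ≤ 2 * (pos (e j) - pos (e i)) := by linarith
    have := mul_le_mul_of_nonneg_left hij' hm
    nlinarith
  have hdistB : ∀ i j, 0 < i → i < j → j < q → ¬ ω i ≤ ω (i - 1) →
      κ (e (i - 1) + 1) ≠ κ (e (j - 1) + 1) := by
    intro i j hi0 hij hj hle heq
    have h1 := hκ (e (i - 1) + 1) (e (j - 1) + 1) (ω (i - 1)) (ω (j - 1))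
      ⟨i - 1, by omega, Or.inr rfl, rfl⟩ ⟨j - 1, by omega, Or.inr rfl, rfl⟩ heq
    have h2 := hright (i - 1) (j - 1) (by omega) (by omega)
    have h4 : pos (e (i - 1) + 1) ≤ pos (e i) := hpos (he (i - 1) i (by omega) (by omega))
    have h5 : pos (e (i - 1) + 1) ≤ pos (e (j - 1)) := hpos (he _ _ (by omega) (by omega))
    have h6 : pos (e i + 1) ≤ pos (e (j - 1) + 1) := by
      rcases Nat.eq_or_lt_of_le (Nat.le_sub_one_of_lt hij) with h | h
      · rw [← h]
      · exact hpos (Nat.succ_le_succ (he i (j - 1) h (by omega)).le)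
    have hA : ω i ≤ pos (e (j - 1) + 1) - pos (e (i - 1) + 1) := by simp only [hω]; linarith
    have hB : ω (j - 1) ≤ pos (e (j - 1) + 1) - pos (e (i - 1) + 1) := by
      simp only [hω]; linarith
    have hi := hω0 (i - 1)
    have hj' := hω0 (j - 1)
    have hij' : ω (i - 1) + ω (j - 1) ≤ 2 * (pos (e (j - 1) + 1) - pos (e (i - 1) + 1)) := by
      linarith [not_le.1 hle]
    have := mul_le_mul_of_nonneg_left hij' hm
    nlinarith
  -- the two candidate pairs of a gap
  set far : ℕ → Prop := fun j =>
    (2 * m + 1) * (pos (y j) - pos (e 0)) + m * W ≤ d (e 0) (y j) with hfar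
  have hnear : ∀ j, ¬ far j →
      (2 * m + 1) * (pos (e (q - 1) + 1) - pos (y j)) + m * W ≤ d (y j) (e (q - 1) + 1) := by
    -- The total excess 2mW is split at the cut vertex, so one of the two halves keeps at least mW.
    intro j hj
    have h1 := htri (e 0) (y j) (e (q - 1) + 1)
    have h2 := not_le.1 hj
    linarith
  set f : ℕ → V × V := fun j =>
    if far j then (κ (e 0), κ (y j)) else (κ (y j), κ (e (q - 1) + 1)) with hf
  -- These gaps have at least two distant edges on either side.
  set J := Finset.Ico 2 (q - 1) with hJ
  have hlab : ∀ i j, (far i ↔ far j) → f i = f j → κ (y i) = κ (y j) := by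
    intro i j h1 h2
    by_cases hi : far i
    · have hj := h1.1 hi
      simp only [hf, if_pos hi, if_pos hj] at h2
      exact (Prod.ext_iff.1 h2).2
    · have hj := fun h => hi (h1.2 h)
      simp only [hf, if_neg hi, if_neg hj] at h2
      exact (Prod.ext_iff.1 h2).1
  have hne : ∀ i j, i ∈ J → j ∈ J → i < j → (ω i ≤ ω (i - 1) ↔ ω j ≤ ω (j - 1)) →
      κ (y i) ≠ κ (y j) := by
    intro i j hi hj hij htype
    rw [hJ, Finset.mem_Ico] at hi hj
    by_cases h : ω i ≤ ω (i - 1)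
    · rw [hyA i h, hyA j (htype.1 h)]
      exact hdistA i j hij (by omega) (htype.1 h)
    · rw [hyB i h, hyB j (fun h' => h (htype.2 h'))]
      exact hdistB i j (by omega) hij (by omega) h
  -- A gap is determined by its pair together with two bits: which half was chosen, and which
  -- neighbouring edge was the shorter one.
  have hcard : J.card ≤ (J.image f).card * 4 := by
    have : J.card ≤ (J.image f ×ˢ (Finset.univ : Finset (Bool × Bool))).card := by
      refine Finset.card_le_card_of_injOn
        (fun j => (f j, decide (far j), decide (ω j ≤ ω (j - 1)))) ?_ ?_
      · intro j hj
        simpa using ⟨j, hj, rfl⟩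
      · intro i hi j hj hij
        simp only [Prod.mk.injEq, decide_eq_decide] at hij
        obtain ⟨h1, h2, h3⟩ := hij
        by_contra hneq
        rcases lt_or_gt_of_ne hneq with h | h
        · exact hne i j hi hj h h3 (hlab i j h2 h1)
        · exact hne j i hj hi h h3.symm (hlab j i h2.symm h1.symm)
    simpa [Finset.card_product] using this
  have he0 : ∀ j, j < q → e 0 ≤ e j := fun j hj => by
    rcases Nat.eq_zero_or_pos j with rfl | h
    · exact le_rfl
    · exact (he 0 j h hj).le
  -- The pair of the outermost endpoints makes the set nonempty, so q ≤ 4|L| + 3 ≤ 7|L| also for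
  -- small q.
  refine ⟨insert (κ (e 0), κ (e (q - 1) + 1)) (J.image f), ?_, ?_⟩
  · have h1 := Finset.card_le_card
      (Finset.subset_insert (κ (e 0), κ (e (q - 1) + 1)) (J.image f))
    have h2 : 1 ≤ (insert (κ (e 0), κ (e (q - 1) + 1)) (J.image f)).card :=
      Finset.card_pos.2 (Finset.insert_nonempty _ _)
    have h3 : J.card = q - 1 - 2 := Nat.card_Ico _ _
    rw [h3] at hcard
    omega
  · intro x hx
    rw [Finset.mem_insert, Finset.mem_image] at hx
    rcases hx with rfl | ⟨j, hj, rfl⟩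
    · refine ⟨_, _, 0, q - 1, ω 0, ω (q - 1), rfl, by omega, by omega, le_rfl, Nat.lt_succ_self _,
        ⟨0, by omega, Or.inl rfl, rfl⟩, ⟨q - 1, by omega, Or.inr rfl, rfl⟩, le_rfl, le_rfl, ?_⟩
      have := mul_nonneg hm hW
      linarith
    · rw [hJ, Finset.mem_Ico] at hj
      have hlt := he (j - 1) j (by omega) (by omega)
      obtain ⟨s, hs1, hs2, hs3, hs4, hs5⟩ : ∃ s, IsEndpoint q e pos (y j) s ∧ s ≤ ω (j - 1) ∧
          s ≤ ω j ∧ e (j - 1) < y j ∧ y j ≤ e j := by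
        by_cases h : ω j ≤ ω (j - 1)
        · exact ⟨ω j, ⟨j, by omega, Or.inl (hyA j h), rfl⟩, h, le_rfl, by rw [hyA j h]; exact hlt,
            (hyA j h).le⟩
        · exact ⟨ω (j - 1), ⟨j - 1, by omega, Or.inr (hyB j h), rfl⟩, le_rfl, (not_le.1 h).le,
            by rw [hyB j h]; exact Nat.lt_succ_self _, by rw [hyB j h]; exact hlt⟩
      by_cases h : far j
      · refine ⟨e 0, y j, 0, j - 1, ω 0, s, by simp only [hf, if_pos h], by omega, by omega, le_rfl,
          hs4, ⟨0, by omega, Or.inl rfl, rfl⟩, hs1, le_rfl, hs2, h⟩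
      · refine ⟨y j, e (q - 1) + 1, j, q - 1, s, ω (q - 1), by simp only [hf, if_neg h], by omega,
          by omega, hs5, Nat.lt_succ_self _, hs1, ⟨q - 1, by omega, Or.inr rfl, rfl⟩, hs3, le_rfl,
          hnear j h⟩

end Pairs

/-! ### Segmentations -/

section Segmentations

/-- The triangle inequality telescopes over the segments; the induction peels off the last one. -/
lemma le_of_segments {B : Finset ℕ} {d : ℕ → ℕ → ℝ} (htri : ∀ a b c, d a c ≤ d a b + d b c)
    (hself : ∀ a, d a a ≤ 0) {F : ℕ → ℝ} (h : ∀ a b, IsSegment B a b → d a b ≤ F b - F a)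
    {a b : ℕ} (ha : a ∈ B) (hb : b ∈ B) (hab : a ≤ b) : d a b ≤ F b - F a := by
  induction b using Nat.strong_induction_on with
  | _ b ih =>
    rcases Nat.eq_or_lt_of_le hab with rfl | hlt
    · simpa using hself a
    · have hne : (B.filter (· < b)).Nonempty := ⟨a, by simp [ha, hlt]⟩
      obtain ⟨hc, hcb⟩ := Finset.mem_filter.1 (Finset.max'_mem _ hne)
      set c := (B.filter (· < b)).max' hne
      have hmax : ∀ r ∈ B, r < b → r ≤ c := fun r hr hrb =>
        Finset.le_max' _ r (by simp [hr, hrb])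
      have h1 := ih c hcb hc (hmax a ha hlt)
      have h2 := h c b ⟨hc, hb, hcb, fun r hr ⟨h3, h4⟩ => absurd (hmax r hr h4) (not_le.2 h3)⟩
      linarith [htri a c b]

/-- The total length of the edges with index in `Q` among the first `b` edges of the path. -/
noncomputable def lengthIn (Q : Finset ℕ) (pos : ℕ → ℝ) (b : ℕ) : ℝ :=
  ∑ r ∈ Finset.range b, if r ∈ Q then pos (r + 1) - pos r else 0

lemma lengthIn_zero (Q : Finset ℕ) (pos : ℕ → ℝ) : lengthIn Q pos 0 = 0 := by simp [lengthIn]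

lemma lengthIn_succ_of_mem {Q : Finset ℕ} {pos : ℕ → ℝ} {r : ℕ} (h : r ∈ Q) :
    lengthIn Q pos (r + 1) = lengthIn Q pos r + (pos (r + 1) - pos r) := by
  rw [lengthIn, lengthIn, Finset.sum_range_succ, if_pos h]

lemma lengthIn_eq {Q : Finset ℕ} {pos : ℕ → ℝ} {a b : ℕ} (hab : a ≤ b)
    (h : ∀ r, a ≤ r → r < b → r ∉ Q) : lengthIn Q pos b = lengthIn Q pos a := by
  induction b, hab using Nat.le_induction with
  | base => rfl
  | succ b hab ih =>
    rw [← ih fun r h1 h2 => h r h1 (by omega)]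
    rw [lengthIn, lengthIn, Finset.sum_range_succ, if_neg (h b hab (Nat.lt_succ_self b)), add_zero]

lemma lengthIn_mono (Q : Finset ℕ) {pos : ℕ → ℝ} (hpos : Monotone pos) :
    Monotone (lengthIn Q pos) := by
  refine monotone_nat_of_le_succ fun r => ?_
  rw [lengthIn, lengthIn, Finset.sum_range_succ]
  split_ifs
  · linarith [hpos (Nat.le_succ r)]
  · simp

variable {V : Type*} {w : Sym2 V → ℝ≥0} {G H : SimpleGraph V}

/-- Merging everything between the two breakpoints creates only one new segment, so low stretch
there would make the merged set an α-segmentation. -/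
lemma IsMinimalSegmentation.lt_wdist {α : ℝ≥0} {x y : V} {P : G.Walk x y} {B : Finset ℕ}
    (h : IsMinimalSegmentation w H α P B) {a b c : ℕ} (ha : a ∈ B) (hb : b ∈ B) (hc : c ∈ B)
    (hac : a < c) (hcb : c < b) :
    α * wdist w G (P.getVert a) (P.getVert b) < wdist w H (P.getVert a) (P.getVert b) := by
  by_contra hle
  obtain ⟨⟨h0, hlen, hbd, hseg⟩, hmin⟩ := h
  refine hmin a ha b hb ⟨c, hc, hac, hcb⟩ ⟨?_, ?_, ?_, ?_⟩
  · simp [mergeSegments, h0]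
  · simp [mergeSegments, hlen, hbd b hb]
  · intro i hi
    exact hbd i (Finset.mem_filter.1 hi).1
  · rintro a' b' ⟨ha', hb', hlt, hcons⟩ hab
    simp only [mergeSegments, Finset.mem_filter] at ha' hb' hcons
    have hA := hcons a ⟨ha, Or.inl le_rfl⟩
    have hB := hcons b ⟨hb, Or.inr le_rfl⟩
    by_cases hout : b' ≤ a ∨ b ≤ a'
    · refine hseg a' b' ⟨ha'.1, hb'.1, hlt, fun r hr hr' => hcons r ⟨hr, ?_⟩ hr'⟩ hab
      rcases hout with h | h <;> omega
    · obtain rfl : a' = a := by omega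
      obtain rfl : b' = b := by omega
      exact not_lt.1 hle

end Segmentations

/-! ### Distances along a segmented shortest path -/

section DistantEdges

variable {V : Type*} {w : Sym2 V → ℝ≥0} {G H : SimpleGraph V}

open Classical in
/-- The indices along `P` of the `α`-distant edges of a segmentation. -/
noncomputable def distantIndices (w : Sym2 V → ℝ≥0) (H : SimpleGraph V) (α : ℝ≥0) {x y : V}
    (P : G.Walk x y) (B : Finset ℕ) : Finset ℕ :=
  (Finset.range P.length).filter fun a => IsSegment B a (a + 1) ∧
    (α * w s(P.getVert a, P.getVert (a + 1)) : ℝ≥0∞) < wdist w H (P.getVert a) (P.getVert (a + 1))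

lemma distantEdges_subset_edgeSet {α : ℝ≥0} {x y : V} {P : G.Walk x y} {B : Finset ℕ}
    (hB : ∀ i ∈ B, i ≤ P.length) : distantEdges w H α P B ⊆ G.edgeSet := by
  rintro e ⟨a, ⟨-, h, -⟩, rfl, -⟩
  exact P.adj_getVert_succ (hB _ h)

lemma distantEdges_subset_image {α : ℝ≥0} {x y : V} {P : G.Walk x y} {B : Finset ℕ}
    (hB : ∀ i ∈ B, i ≤ P.length) :
    distantEdges w H α P B ⊆
      (fun a => s(P.getVert a, P.getVert (a + 1))) '' (distantIndices w H α P B : Set ℕ) := by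
  rintro e ⟨a, hseg, rfl, hlt⟩
  refine ⟨a, ?_, rfl⟩
  have : a < P.length := hB _ hseg.2.1
  simp [distantIndices, this, hseg, hlt]

lemma ncard_distantEdges_le {α : ℝ≥0} {x y : V} {P : G.Walk x y} {B : Finset ℕ}
    (hB : ∀ i ∈ B, i ≤ P.length) :
    (distantEdges w H α P B).ncard ≤ (distantIndices w H α P B).card := by
  rw [← Set.ncard_coe_finset]
  exact (Set.ncard_le_ncard (distantEdges_subset_image hB) ((Finset.finite_toSet _).image _)).trans
    (Set.ncard_image_le (Finset.finite_toSet _))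

lemma toReal_mul_wdist (α : ℝ≥0) (x y : V) :
    (α * wdist w G x y).toReal = α * rdist w G x y := by
  simp [rdist]

/-- Distances along a segmented shortest path, in a graph that contains `H` and in which the
distant edges have stretch at most `α + c`. -/
lemma rdist_getVert_le_of_isSegmentation {α : ℝ≥0} {x y : V} {P : G.Walk x y} {B : Finset ℕ}
    (hP : IsShortestPath w P) (hB : IsSegmentation w H α P B) {H' : SimpleGraph V} (hH : H ≤ H')
    (hreach : ∀ u v, G.Reachable u v → H.Reachable u v) {c : ℝ}
    (hc : ∀ r ∈ distantIndices w H α P B, rdist w H' (P.getVert r) (P.getVert (r + 1)) ≤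
      (α + c) * (position w P (r + 1) - position w P r))
    {a b : ℕ} (ha : a ∈ B) (hb : b ∈ B) (hab : a ≤ b) :
    rdist w H' (P.getVert a) (P.getVert b) ≤ α * (position w P b - position w P a) +
      c * (lengthIn (distantIndices w H α P B) (position w P) b -
        lengthIn (distantIndices w H α P B) (position w P) a) := by
  set Q := distantIndices w H α P B with hQ
  have hr : ∀ i j, H.Reachable (P.getVert i) (P.getVert j) := fun i j =>
    hreach _ _ (reachable_getVert_getVert P i j)
  have key := le_of_segments (B := B) (d := fun a b => rdist w H' (P.getVert a) (P.getVert b))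
    (fun a b c => rdist_triangle ((hr a b).mono hH) ((hr b c).mono hH))
    (fun a => (rdist_self _).le)
    (F := fun b => α * position w P b + c * lengthIn Q (position w P) b) ?_ ha hb hab
  · refine key.trans (le_of_eq ?_)
    ring
  · intro a b hseg
    have hble := hB.2.2.1 b hseg.2.1
    by_cases hmem : b = a + 1 ∧ a ∈ Q
    · obtain ⟨rfl, haQ⟩ := hmem
      have h := hc a haQ
      rw [lengthIn_succ_of_mem haQ]
      linarith
    · have hnone : lengthIn Q (position w P) b = lengthIn Q (position w P) a := by
        refine lengthIn_eq hseg.2.2.1.le fun r h1 h2 hrQ => ?_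
        have h3 : IsSegment B r (r + 1) := by
          rw [hQ] at hrQ
          simp only [distantIndices, Finset.mem_filter] at hrQ
          exact hrQ.2.1
        rcases Nat.eq_or_lt_of_le h1 with rfl | h4
        · refine hseg.2.2.2 (a + 1) h3.2.1 ⟨Nat.lt_succ_self a, ?_⟩
          rcases Nat.eq_or_lt_of_le (Nat.succ_le_of_lt h2) with h5 | h5
          · exact absurd ⟨h5.symm, hrQ⟩ hmem
          · exact h5
        · exact hseg.2.2.2 r h3.1 ⟨h4, h2⟩
      have hstretch : wdist w H (P.getVert a) (P.getVert b) ≤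
          α * wdist w G (P.getVert a) (P.getVert b) := by
        rcases Nat.eq_or_lt_of_le (Nat.succ_le_of_lt hseg.2.2.1) with h5 | h5
        · by_contra hlt
          refine hmem ⟨h5.symm, ?_⟩
          have h5' : b = a + 1 := h5.symm
          subst h5'
          simp only [hQ, distantIndices, Finset.mem_filter, Finset.mem_range]
          refine ⟨hble, hseg, ?_⟩
          have h6 : wdist w G (P.getVert a) (P.getVert (a + 1)) =
              w s(P.getVert a, P.getVert (a + 1)) := by
            rw [← ofReal_rdist (reachable_getVert_getVert P a (a + 1)),
              hP.rdist_getVert (Nat.le_succ a) hble, position_succ]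
            simp
          rw [h6] at hlt
          exact not_le.1 hlt
        · exact hB.2.2.2 a b hseg h5
      have h7 : rdist w H (P.getVert a) (P.getVert b) ≤
          α * (position w P b - position w P a) := by
        rw [← hP.rdist_getVert hseg.2.2.1.le hble, ← toReal_mul_wdist]
        refine ENNReal.toReal_mono (ENNReal.mul_ne_top ENNReal.coe_ne_top ?_) hstretch
        exact wdist_ne_top_iff.2 (reachable_getVert_getVert P a b)
      have h8 := rdist_anti (w := w) hH (hr a b)
      rw [hnone]
      linarith

lemma mul_rdist_lt {α : ℝ≥0} (hreach : ∀ u v, G.Reachable u v → H.Reachable u v) {x y : V}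
    (hxy : G.Reachable x y) (h : α * wdist w G x y < wdist w H x y) :
    α * rdist w G x y < rdist w H x y := by
  rw [← toReal_mul_wdist]
  exact ENNReal.toReal_strict_mono (wdist_ne_top_iff.2 (hreach _ _ hxy)) h

lemma mem_distantIndices_iff {α : ℝ≥0} {x y : V} {P : G.Walk x y} {B : Finset ℕ}
    (hP : IsShortestPath w P) {r : ℕ} (hr : r ∈ distantIndices w H α P B) :
    r ∈ B ∧ r + 1 ∈ B ∧ r < P.length ∧
      (α * w s(P.getVert r, P.getVert (r + 1)) : ℝ≥0∞) <
        wdist w H (P.getVert r) (P.getVert (r + 1)) ∧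
      wdist w G (P.getVert r) (P.getVert (r + 1)) = w s(P.getVert r, P.getVert (r + 1)) := by
  simp only [distantIndices, Finset.mem_filter, Finset.mem_range] at hr
  refine ⟨hr.2.1.1, hr.2.1.2.1, hr.1, hr.2.2, ?_⟩
  rw [← ofReal_rdist (reachable_getVert_getVert P r (r + 1)),
    hP.rdist_getVert (Nat.le_succ r) hr.1, position_succ]
  simp

/-- By minimality, subpaths that start or end with a distant edge have stretch more than `α`. -/
lemma IsMinimalSegmentation.lt_rdist {α : ℝ≥0} {x y : V} {P : G.Walk x y} {B : Finset ℕ}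
    (hP : IsShortestPath w P) (hB : IsMinimalSegmentation w H α P B)
    (hreach : ∀ u v, G.Reachable u v → H.Reachable u v) {a b : ℕ} (ha : a ∈ B) (hb : b ∈ B)
    (hab : a < b)
    (hQ : a ∈ distantIndices w H α P B ∨ ∃ r ∈ distantIndices w H α P B, b = r + 1) :
    α * (position w P b - position w P a) < rdist w H (P.getVert a) (P.getVert b) := by
  have hble := hB.1.2.2.1 b hb
  rw [← hP.rdist_getVert hab.le hble]
  refine mul_rdist_lt hreach (reachable_getVert_getVert P a b) ?_
  -- Either the subpath is the distant edge itself, or the other endpoint of that edge is an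
  -- interior breakpoint and minimality applies.
  rcases hQ with h | ⟨r, h, rfl⟩
  · obtain ⟨h1, h2, h3, h4, h5⟩ := mem_distantIndices_iff hP h
    rcases Nat.eq_or_lt_of_le (Nat.succ_le_of_lt hab) with rfl | h6
    · exact h5.symm ▸ h4
    · exact hB.lt_wdist ha hb h2 (Nat.lt_succ_self a) h6
  · obtain ⟨h1, h2, h3, h4, h5⟩ := mem_distantIndices_iff hP h
    rcases Nat.eq_or_lt_of_le (Nat.le_of_lt_succ hab) with rfl | h6
    · exact h5.symm ▸ h4
    · exact hB.lt_wdist ha hb h1 h6 (Nat.lt_succ_self r)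

end DistantEdges

/-! ### The potential of a pair of clusters -/

section Potential

variable {V : Type*} {w : Sym2 V → ℝ≥0} {G H H' : SimpleGraph V}

/-- The distance in `H` of two centers, truncated to an interval of length `(8 * m + 7) * m * W`
around `2 * m + 1` times their distance in `G`. -/
noncomputable def pairPotential (w : Sym2 V → ℝ≥0) (G : SimpleGraph V) (m W : ℝ)
    (H : SimpleGraph V) (x : V × V) : ℝ :=
  max ((2 * m + 1) * (rdist w G x.1 x.2 - 2 * m * W) - 2 * (m * W))
    (min ((2 * m + 1) * (rdist w G x.1 x.2 + 2 * m * W) + m * W) (rdist w H x.1 x.2))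

/-- Both values lie in the truncation window, whose length is (2m + 1) · 4mW + 3mW. -/
lemma pairPotential_sub_le {m W : ℝ} (hm : 0 ≤ m) (hW : 0 ≤ W) (x : V × V) :
    pairPotential w G m W H x - pairPotential w G m W H' x ≤ (8 * m + 7) * (m * W) := by
  have h0 := mul_nonneg hm hW
  have h0' := mul_nonneg hm h0
  have h1 : pairPotential w G m W H x ≤
      (2 * m + 1) * (rdist w G x.1 x.2 + 2 * m * W) + m * W :=
    max_le (by nlinarith) (min_le_left _ _)
  have h2 : (2 * m + 1) * (rdist w G x.1 x.2 - 2 * m * W) - 2 * (m * W) ≤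
    pairPotential w G m W H' x := le_max_left _ _
  nlinarith

lemma pairPotential_anti {m W : ℝ} (hH : H ≤ H') (hH' : H' ≤ G)
    (hreach : ∀ u v, G.Reachable u v → H.Reachable u v) (x : V × V) :
    pairPotential w G m W H' x ≤ pairPotential w G m W H x := by
  have : rdist w H' x.1 x.2 ≤ rdist w H x.1 x.2 := by
    by_cases h : H.Reachable x.1 x.2
    · exact rdist_anti hH h
    · have h' : ¬ H'.Reachable x.1 x.2 := fun h' => h (hreach _ _ (h'.mono hH'))
      have h1 : wdist w H' x.1 x.2 = ⊤ := by
        by_contra h2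
        exact h' (wdist_ne_top_iff.1 h2)
      simp only [rdist, h1, ENNReal.toReal_top]
      exact ENNReal.toReal_nonneg
  exact max_le_max le_rfl (min_le_min le_rfl this)

/-- The window extends mW below the bound in `h2` and mW above the bound in `h3`, so truncation
cannot swallow any of the drop mW. -/
lemma pairPotential_add_le {m W : ℝ} (hm : 0 ≤ m) (hW : 0 ≤ W) {x : V × V}
    (h1 : rdist w H' x.1 x.2 + m * W ≤ rdist w H x.1 x.2)
    (h2 : (2 * m + 1) * (rdist w G x.1 x.2 - 2 * m * W) - m * W ≤ rdist w H x.1 x.2)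
    (h3 : rdist w H' x.1 x.2 ≤ (2 * m + 1) * (rdist w G x.1 x.2 + 2 * m * W)) :
    pairPotential w G m W H' x + m * W ≤ pairPotential w G m W H x := by
  have h0 := mul_nonneg hm hW
  have h0' := mul_nonneg hm h0
  have h4 : pairPotential w G m W H' x ≤
      max ((2 * m + 1) * (rdist w G x.1 x.2 - 2 * m * W) - 2 * (m * W)) (rdist w H' x.1 x.2) :=
    max_le_max le_rfl (min_le_right _ _)
  have h5 : min ((2 * m + 1) * (rdist w G x.1 x.2 + 2 * m * W) + m * W) (rdist w H x.1 x.2) ≤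
    pairPotential w G m W H x := le_max_right _ _
  refine (add_le_add_left h4 _).trans (le_trans ?_ h5)
  rw [← le_sub_iff_add_le]
  refine max_le ?_ ?_ <;> rw [le_sub_iff_add_le] <;> refine le_min ?_ ?_ <;> nlinarith

end Potential

/-! ### The number of edges added by the completion -/

section Completion

variable {V : Type*} {w : Sym2 V → ℝ≥0} {G H₀ H H' : SimpleGraph V} {m : ℕ} {ctr : V → V}

lemma IsClusteredSpanner.reachable {S : Set V} (h : IsClusteredSpanner w G m S ctr H₀)
    (hH : H₀ ≤ H) (u v : V) (huv : G.Reachable u v) : H.Reachable u v := by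
  refine (reachable_mono_of_adj (H := H₀) (fun u v huv => ?_) huv).mono hH
  refine reachable_of_wdist_le (w := w) (r := ((4 * m + 1 : ℕ) : ℝ≥0) * w s(u, v)) ?_
  exact_mod_cast h.stretch u v huv

/-- The total potential of all pairs of centers. -/
noncomputable def totalPotential (w : Sym2 V → ℝ≥0) (G : SimpleGraph V) (m W : ℝ) (S : Finset V)
    (H : SimpleGraph V) : ℝ :=
  ∑ x ∈ S ×ˢ S, pairPotential w G m W H x

/-- Every new edge is paid for by a drop of potential. The positivity claim says that a step can
occur only if mW > 0, which later allows division by mW. -/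
lemma CompletionStep.totalPotential_drop [Finite V] {S : Finset V}
    (hw : ∀ e ∈ G.edgeSet, 0 < w e)
    (hcl : IsClusteredSpanner w G m S ctr H₀) (hH₀ : H₀ ≤ H) (hHG : H ≤ G)
    (hstep : CompletionStep w G ((2 * m + 1 : ℕ) : ℝ≥0) ((2 * m : ℕ) : ℝ≥0) H H') :
    H ≤ H' ∧ H' ≤ G ∧ 0 < (m : ℝ) * (maxWeight w G).toReal ∧
      (m : ℝ) * (maxWeight w G).toReal * (H'.edgeSet \ H.edgeSet).ncard ≤
        7 * (totalPotential w G m (maxWeight w G).toReal S H -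
          totalPotential w G m (maxWeight w G).toReal S H') := by
  obtain ⟨x, y, P, B, hlt, hP, hmin, rfl⟩ := hstep
  set α : ℝ≥0 := ((2 * m + 1 : ℕ) : ℝ≥0) with hα
  set W : ℝ := (maxWeight w G).toReal with hWdef
  have hαr : (α : ℝ) = 2 * m + 1 := by simp [hα]
  have hW0 : 0 ≤ W := ENNReal.toReal_nonneg
  have hm0 : (0 : ℝ) ≤ m := Nat.cast_nonneg m
  have hB := hmin.1
  have hBle := hB.2.2.1
  have hreach := hcl.reachable hH₀
  set H' := H ⊔ SimpleGraph.fromEdgeSet (distantEdges w H α P B) with hH'def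
  have hHH' : H ≤ H' := le_sup_left
  have hH'G : H' ≤ G := by
    refine sup_le hHG fun u v h => ?_
    have := distantEdges_subset_edgeSet hBle ((SimpleGraph.fromEdgeSet_adj _).1 h).1
    exact this
  have hxy : G.Reachable x y := P.reachable
  -- the pair `x`, `y` violates the stretch bound
  have hviol : (2 * m + 1) * position w P P.length + 2 * m * W < rdist w H x y := by
    have h1 := ENNReal.toReal_strict_mono (wdist_ne_top_iff.2 (hreach _ _ hxy)) hlt
    rw [ENNReal.toReal_add (ENNReal.mul_ne_top ENNReal.coe_ne_top (wdist_ne_top_iff.2 hxy))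
      (ENNReal.mul_ne_top ENNReal.coe_ne_top maxWeight_ne_top), toReal_mul_wdist,
      hP.rdist_eq, hαr, ENNReal.toReal_mul] at h1
    simpa [rdist] using h1
  set Q := distantIndices w H α P B with hQ
  set pos := position w P with hpos
  have hposmono : Monotone pos := position_mono P
  have hsucc : ∀ r, pos (r + 1) - pos r = w s(P.getVert r, P.getVert (r + 1)) := fun r => by
    rw [hpos, position_succ]; ring
  have hQmem : ∀ r ∈ Q, _ := fun r hr => mem_distantIndices_iff hP hr
  have hQadj : ∀ r ∈ Q, G.Adj (P.getVert r) (P.getVert (r + 1)) := fun r hr =>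
    P.adj_getVert_succ (hQmem r hr).2.2.1
  -- distances along the path before and after the step
  have hbefore : ∀ {a b : ℕ}, a ∈ B → b ∈ B → a ≤ b → rdist w H (P.getVert a) (P.getVert b) ≤
      (2 * m + 1) * (pos b - pos a) + 2 * m * (lengthIn Q pos b - lengthIn Q pos a) := by
    intro a b ha hb hab
    rw [← hαr]
    refine rdist_getVert_le_of_isSegmentation hP hB le_rfl hreach (fun r hr => ?_) ha hb hab
    have h1 : wdist w H (P.getVert r) (P.getVert (r + 1)) ≤
        (((4 * m + 1 : ℕ) : ℝ≥0) * w s(P.getVert r, P.getVert (r + 1)) : ℝ≥0) := by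
      refine (wdist_anti hH₀ _ _).trans ((hcl.stretch _ _ (hQadj r hr)).trans (le_of_eq ?_))
      push_cast; rfl
    -- The stretch 4m + 1 of the spanner is α + 2m.
    refine (rdist_le_of_wdist_le h1).trans (le_of_eq ?_)
    rw [← hpos, hsucc, hαr]
    push_cast; ring
  have hafter : ∀ {a b : ℕ}, a ∈ B → b ∈ B → a ≤ b → rdist w H' (P.getVert a) (P.getVert b) ≤
      (2 * m + 1) * (pos b - pos a) + -(2 * m) * (lengthIn Q pos b - lengthIn Q pos a) := by
    intro a b ha hb hab
    rw [← hαr]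
    refine rdist_getVert_le_of_isSegmentation hP hB hHH' hreach (fun r hr => ?_) ha hb hab
    have hadj : H'.Adj (P.getVert r) (P.getVert (r + 1)) := by
      rw [hH'def, SimpleGraph.sup_adj, SimpleGraph.fromEdgeSet_adj]
      refine Or.inr ⟨⟨r, ?_, rfl, (hQmem r hr).2.2.2.1⟩, (hQadj r hr).ne⟩
      simp only [distantIndices, Finset.mem_filter] at hr
      exact hr.2.1
    -- An added edge has stretch at most 1 = α − 2m.
    refine (rdist_le_of_adj hadj).trans (le_of_eq ?_)
    rw [← hpos, hsucc, hαr]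
    ring
  have hcummono := lengthIn_mono Q hposmono
  -- the distant edges in their order along the path
  set q := Q.card with hq
  obtain ⟨e, heQ, hemono, hesurj⟩ : ∃ e : ℕ → ℕ, (∀ j < q, e j ∈ Q) ∧
      (∀ i j, i < j → j < q → e i < e j) ∧ ∀ r ∈ Q, ∃ j < q, e j = r := by
    refine ⟨fun j => if h : j < q then Q.orderEmbOfFin rfl ⟨j, h⟩ else 0, ?_, ?_, ?_⟩
    · intro j hj
      simp only [dif_pos hj]
      exact Finset.orderEmbOfFin_mem _ _ _
    · intro i j hij hj
      simp only [dif_pos hj, dif_pos (hij.trans hj)]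
      exact (Q.orderEmbOfFin rfl).strictMono hij
    · intro r hr
      have : r ∈ Set.range (Q.orderEmbOfFin rfl) := by
        rw [Finset.range_orderEmbOfFin]; exact hr
      obtain ⟨j, rfl⟩ := this
      exact ⟨j, j.2, dif_pos j.2⟩
  have hemono' : ∀ i j, i ≤ j → j < q → e i ≤ e j := by
    intro i j hij hj
    rcases Nat.eq_or_lt_of_le hij with rfl | h
    · exact le_rfl
    · exact (hemono i j h hj).le
  have hwle : ∀ r ∈ Q, pos (r + 1) - pos r ≤ W := fun r hr => by
    rw [hsucc]
    exact le_toReal_maxWeight ((SimpleGraph.mem_edgeSet _).2 (hQadj r hr))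
  -- the part of the path before the first and after the last distant edge
  have hhead : ∀ r, (∀ i ∈ Q, r ≤ i) → lengthIn Q pos r = 0 := fun r hr => by
    rw [← lengthIn_zero Q pos]
    exact lengthIn_eq (Nat.zero_le r) fun i _ h2 h3 => absurd (hr i h3) (by omega)
  have htail : ∀ r ≤ P.length, (∀ i ∈ Q, i < r) →
      lengthIn Q pos P.length = lengthIn Q pos r := fun r hrl hr =>
    lengthIn_eq hrl fun i h1 _ h3 => absurd (hr i h3) (by omega)
  have hfull := hbefore hB.1 hB.2.1 (Nat.zero_le _)
  simp only [SimpleGraph.Walk.getVert_zero, SimpleGraph.Walk.getVert_length,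
    lengthIn_zero, sub_zero] at hfull
  have hpos0 : pos 0 = 0 := position_zero P
  rw [hpos0, sub_zero] at hfull
  -- The additive error 2mW can only come from the distant edges, so their total length exceeds W.
  -- This forces m > 0 and at least two of them.
  have hcum : (m : ℝ) * W < m * lengthIn Q pos P.length := by linarith
  have hq2 : 2 ≤ q := by
    by_contra hq2
    have hle : lengthIn Q pos P.length ≤ W := by
      rcases Nat.lt_or_ge 0 q with h1 | h1
      · have hlast : ∀ i ∈ Q, i = e 0 := fun i hi => by
          obtain ⟨j, hj, rfl⟩ := hesurj i hi
          rw [show j = 0 by omega]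
        rw [htail (e 0 + 1) (hQmem _ (heQ 0 h1)).2.2.1 (fun i hi => by rw [hlast i hi]; omega),
          lengthIn_succ_of_mem (heQ 0 h1), hhead (e 0) (fun i hi => (hlast i hi).ge), zero_add]
        exact hwle _ (heQ 0 h1)
      · have h2 : Q = ∅ := Finset.card_eq_zero.1 (by omega)
        rw [hhead P.length (fun i hi => by simp [h2] at hi)]
        exact hW0
    nlinarith
  have hmpos : (0 : ℝ) < m := by
    rcases hm0.eq_or_lt with h | h
    · rw [← h] at hcum; simp at hcum
    · exact h
  have hWpos : 0 < W := by
    have h1 := heQ 0 (by omega)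
    have h2 := hw _ ((SimpleGraph.mem_edgeSet _).2 (hQadj _ h1))
    have h3 := hwle _ h1
    rw [hsucc] at h3
    exact lt_of_lt_of_le (by exact_mod_cast h2) h3
  refine ⟨hHH', hH'G, mul_pos hmpos hWpos, ?_⟩
  -- endpoints of distant edges are close to their centers
  have hend : ∀ a r, IsEndpoint q e pos a r → a ∈ B ∧ r ≤ W ∧ ctr (P.getVert a) ∈ S ∧
      H₀.Reachable (ctr (P.getVert a)) (P.getVert a) ∧
      rdist w H₀ (ctr (P.getVert a)) (P.getVert a) ≤ m * r := by
    rintro a r ⟨j, hj, haj, rfl⟩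
    obtain ⟨h1, h2, h3, h4, h5⟩ := hQmem _ (heQ j hj)
    have hadj := hQadj _ (heQ j hj)
    have h6 : ((2 * m + 1 : ℕ) : ℝ≥0∞) * w s(P.getVert (e j), P.getVert (e j + 1)) <
        wdist w H₀ (P.getVert (e j)) (P.getVert (e j + 1)) := by
      refine lt_of_lt_of_le ?_ (wdist_anti hH₀ _ _)
      simpa [hα] using h4
    have h7 : ctr (P.getVert a) ∈ (S : Set V) ∧
        wdist w H₀ (ctr (P.getVert a)) (P.getVert a) ≤
          (((m : ℝ≥0) * w s(P.getVert (e j), P.getVert (e j + 1)) : ℝ≥0) : ℝ≥0∞) := by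
      push_cast
      rcases haj with rfl | rfl
      · exact hcl.center _ _ hadj h6
      · rw [wdist_comm, Sym2.eq_swap] at h6
        rw [Sym2.eq_swap]
        exact hcl.center _ _ hadj.symm h6
    refine ⟨by rcases haj with rfl | rfl <;> assumption, hwle _ (heQ j hj), h7.1,
      reachable_of_wdist_le h7.2, ?_⟩
    rw [hsucc]
    simpa using rdist_le_of_wdist_le h7.2
  have hrG : ∀ i j, G.Reachable (P.getVert i) (P.getVert j) := reachable_getVert_getVert P
  have hrH : ∀ i j, H.Reachable (P.getVert i) (P.getVert j) := fun i j => hreach _ _ (hrG i j)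
  obtain ⟨L, hLcard, hL⟩ := exists_label_pairs (V := V) hm0 hW0 hq2 hemono hposmono
    (d := fun a b => rdist w H (P.getVert a) (P.getVert b))
    (fun a b c => rdist_triangle (hrH a b) (hrH b c)) (κ := fun a => ctr (P.getVert a))
    (by
      intro a b r s ha hb hab
      obtain ⟨-, -, -, h1, h2⟩ := hend a r ha
      obtain ⟨-, -, -, h3, h4⟩ := hend b s hb
      rw [← hab] at h3 h4
      have h5 := rdist_triangle (w := w) (h1.mono hH₀).symm (h3.mono hH₀)
      have h6 := rdist_anti (w := w) hH₀ h1
      have h7 := rdist_anti (w := w) hH₀ h3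
      rw [rdist_comm (P.getVert a) (ctr _)] at h5
      linarith)
    (by
      intro i j hij hj
      rw [← hαr]
      exact hmin.lt_rdist hP hreach (hQmem _ (heQ i (by omega))).1 (hQmem _ (heQ j hj)).1
        (hemono i j hij hj) (Or.inl (heQ i (by omega))))
    (by
      intro i j hij hj
      rw [← hαr]
      exact hmin.lt_rdist hP hreach (hQmem _ (heQ i (by omega))).2.1 (hQmem _ (heQ j hj)).2.1
        (Nat.succ_lt_succ (hemono i j hij hj)) (Or.inr ⟨_, heQ j hj, rfl⟩))
    (by
      -- Before the first and after the last distant edge the stretch is at most α, so the whole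
      -- excess sits in between.
      have hf := hQmem _ (heQ 0 (by omega))
      have hl := hQmem _ (heQ (q - 1) (by omega))
      have hfirst : lengthIn Q pos (e 0) = 0 := hhead _ fun i hi => by
        obtain ⟨j, hj, rfl⟩ := hesurj i hi
        exact hemono' 0 j (Nat.zero_le _) hj
      have hlast : lengthIn Q pos P.length = lengthIn Q pos (e (q - 1) + 1) :=
        htail _ hl.2.2.1 fun i hi => by
          obtain ⟨j, hj, rfl⟩ := hesurj i hi
          exact Nat.lt_succ_of_le (hemono' j (q - 1) (by omega) (by omega))
      have h1 := hbefore hB.1 hf.1 (Nat.zero_le _)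
      have h2 := hbefore hl.2.1 hB.2.1 hl.2.2.1
      rw [hfirst, lengthIn_zero, hpos0] at h1
      rw [hlast] at h2
      have h3 := rdist_triangle (w := w) (hrH 0 (e 0)) (hrH (e 0) P.length)
      have h4 := rdist_triangle (w := w) (hrH (e 0) (e (q - 1) + 1))
        (hrH (e (q - 1) + 1) P.length)
      simp only [SimpleGraph.Walk.getVert_zero, SimpleGraph.Walk.getVert_length] at h1 h2 h3 h4
      linarith)
  -- each of these pairs loses potential
  have hdrop : ∀ z ∈ L, z ∈ S ×ˢ S ∧
      pairPotential w G m W H' z + m * W ≤ pairPotential w G m W H z := by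
    intro z hz
    obtain ⟨a, b, i, j, r, s, rfl, hij, hj, hai, hjb, hra, hsb, hr, hs, hex⟩ := hL z hz
    obtain ⟨haB, hrW, haS, hca, hda⟩ := hend a r hra
    obtain ⟨hbB, hsW, hbS, hcb, hdb⟩ := hend b s hsb
    have hab : a ≤ b := (hai.trans (hemono i j hij hj).le).trans hjb.le
    refine ⟨Finset.mem_product.2 ⟨haS, hbS⟩, ?_⟩
    -- The distinct distant edges i < j both lie in the subpath and have lengths at least r and s.
    have hlen : r + s ≤ lengthIn Q pos b - lengthIn Q pos a := by
      have h1 := lengthIn_succ_of_mem (pos := pos) (heQ i (by omega))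
      have h2 := lengthIn_succ_of_mem (pos := pos) (heQ j hj)
      have h3 := hcummono hai
      have h4 := hcummono (Nat.succ_le_of_lt (hemono i j hij hj))
      have h5 := hcummono (Nat.succ_le_of_lt hjb)
      simp only [Nat.succ_eq_add_one] at h4 h5
      linarith
    have hlen' := mul_le_mul_of_nonneg_left hlen hm0
    have haft := hafter haB hbB hab
    have hdG := hP.rdist_getVert hab (hBle b hbB)
    rw [← hpos] at hdG
    have hmr := mul_le_mul_of_nonneg_left hrW hm0
    have hms := mul_le_mul_of_nonneg_left hsW hm0
    -- comparison of the distance of the centers with that of the vertices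
    have hcmp : ∀ K : SimpleGraph V, H₀ ≤ K →
        K.Reachable (P.getVert a) (P.getVert b) →
        rdist w K (ctr (P.getVert a)) (ctr (P.getVert b)) ≤
            rdist w K (P.getVert a) (P.getVert b) + m * r + m * s ∧
          rdist w K (P.getVert a) (P.getVert b) ≤
            rdist w K (ctr (P.getVert a)) (ctr (P.getVert b)) + m * r + m * s := by
      intro K hK hKr
      have h1 := (rdist_anti (w := w) hK hca).trans hda
      have h2 := (rdist_anti (w := w) hK hcb).trans hdb
      have hca' := hca.mono hK
      have hcb' := hcb.mono hK
      have h3 := rdist_triangle (w := w) hca' (hKr.trans hcb'.symm)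
      have h4 := rdist_triangle (w := w) hKr hcb'.symm
      have h5 := rdist_triangle (w := w) hca'.symm ((hca'.trans hKr))
      have h6 := rdist_triangle (w := w) ((hca'.trans hKr).trans hcb'.symm) hcb'
      rw [rdist_comm (P.getVert b)] at h4
      rw [rdist_comm (P.getVert a) (ctr _)] at h5
      constructor <;> linarith
    obtain ⟨-, hD1⟩ := hcmp H hH₀ (hrH a b)
    obtain ⟨hD2, -⟩ := hcmp H' (hH₀.trans hHH') ((hrH a b).mono hHH')
    obtain ⟨hG1, hG2⟩ := hcmp G (hH₀.trans hHG) (hrG a b)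
    rw [hdG] at hG1 hG2
    have hA1 : (2 * m + 1) * (rdist w G (ctr (P.getVert a)) (ctr (P.getVert b)) - 2 * m * W) ≤
        (2 * m + 1) * (pos b - pos a) := by
      refine mul_le_mul_of_nonneg_left ?_ (by positivity)
      linarith
    have hA2 : (2 * m + 1) * (pos b - pos a) ≤
        (2 * m + 1) * (rdist w G (ctr (P.getVert a)) (ctr (P.getVert b)) + 2 * m * W) := by
      refine mul_le_mul_of_nonneg_left ?_ (by positivity)
      linarith
    have hr0 : 0 ≤ m * r := (rdist_nonneg _ _).trans hda
    have hs0 : 0 ≤ m * s := (rdist_nonneg _ _).trans hdb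
    -- The gain 2m(r + s) from the added edges cancels the detours to the centers in `hD1` and
    -- `hD2`, and the excess mW is left.
    refine pairPotential_add_le hm0 hW0 ?_ ?_ ?_
    · simp only; linarith
    · simp only; linarith
    · simp only; linarith
  have hanti : ∀ z ∈ S ×ˢ S, pairPotential w G m W H' z ≤ pairPotential w G m W H z :=
    fun z _ => pairPotential_anti hHH' hH'G hreach z
  have hsum : (L.card : ℝ) * (m * W) ≤
      totalPotential w G m W S H - totalPotential w G m W S H' := by
    rw [totalPotential, totalPotential, ← Finset.sum_sub_distrib, ← nsmul_eq_mul]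
    refine (Finset.card_nsmul_le_sum L
      (fun z => pairPotential w G m W H z - pairPotential w G m W H' z) _ fun z hz => ?_).trans
      (Finset.sum_le_sum_of_subset_of_nonneg (fun z hz => (hdrop z hz).1) fun z hz _ => ?_)
    · have := (hdrop z hz).2
      linarith
    · have := hanti z hz
      linarith
  have hnew : ((H'.edgeSet \ H.edgeSet).ncard : ℝ) ≤ 7 * L.card := by
    have h1 : H'.edgeSet \ H.edgeSet ⊆ distantEdges w H α P B := by
      rw [hH'def, SimpleGraph.edgeSet_sup, SimpleGraph.edgeSet_fromEdgeSet]
      rintro z ⟨h2 | h2, h3⟩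
      · exact absurd h2 h3
      · exact h2.1
    have h2 := (Set.ncard_le_ncard h1 (Set.toFinite _)).trans (ncard_distantEdges_le hBle)
    exact_mod_cast h2.trans hLcard
  have := mul_le_mul_of_nonneg_left hnew (mul_pos hmpos hWpos).le
  linarith

/-- The completion of a clustered spanner adds few edges. -/
lemma CompletionReaches.ncard_le [Finite V] {S : Finset V} (hw : ∀ e ∈ G.edgeSet, 0 < w e)
    (hcl : IsClusteredSpanner w G m S ctr H₀)
    (h : CompletionReaches w G ((2 * m + 1 : ℕ) : ℝ≥0) ((2 * m : ℕ) : ℝ≥0) H₀ H) :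
    ((H.edgeSet \ H₀.edgeSet).ncard : ℝ) ≤ 7 * (8 * m + 7) * (S.card : ℝ) ^ 2 := by
  set W : ℝ := (maxWeight w G).toReal with hW
  have hW0 : 0 ≤ W := ENNReal.toReal_nonneg
  have hm0 : (0 : ℝ) ≤ m := Nat.cast_nonneg m
  have key : H₀ ≤ H ∧ H ≤ G ∧ (H = H₀ ∨ 0 < (m : ℝ) * W) ∧
      (m : ℝ) * W * (H.edgeSet \ H₀.edgeSet).ncard ≤
        7 * (totalPotential w G m W S H₀ - totalPotential w G m W S H) := by
    induction h with
    | refl => exact ⟨le_rfl, hcl.le, Or.inl rfl, by simp⟩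
    | @tail K K' _ hstep ih =>
      obtain ⟨h1, h2, -, h3⟩ := ih
      obtain ⟨h4, h5, h6, h7⟩ := hstep.totalPotential_drop hw hcl h1 h2
      refine ⟨h1.trans h4, h5, Or.inr h6, ?_⟩
      have h8 : (K'.edgeSet \ H₀.edgeSet).ncard ≤
          (K.edgeSet \ H₀.edgeSet).ncard + (K'.edgeSet \ K.edgeSet).ncard := by
        refine (Set.ncard_le_ncard (fun z hz => ?_) (Set.toFinite _)).trans
          (Set.ncard_union_le _ _)
        by_cases hzK : z ∈ K.edgeSet
        · exact Or.inl ⟨hzK, hz.2⟩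
        · exact Or.inr ⟨hz.1, hzK⟩
      have h9 : ((K'.edgeSet \ H₀.edgeSet).ncard : ℝ) ≤
          (K.edgeSet \ H₀.edgeSet).ncard + (K'.edgeSet \ K.edgeSet).ncard := by
        exact_mod_cast h8
      have := mul_le_mul_of_nonneg_left h9 h6.le
      linarith
  -- If no step was made, mW may vanish, but then nothing was added.
  obtain ⟨-, -, rfl | hpos, hle⟩ := key
  · simp only [sdiff_self, Set.bot_eq_empty, Set.ncard_empty, Nat.cast_zero]
    positivity
  · have h1 : totalPotential w G m W S H₀ - totalPotential w G m W S H ≤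
        (S.card : ℝ) ^ 2 * ((8 * m + 7) * (m * W)) := by
      rw [totalPotential, totalPotential, ← Finset.sum_sub_distrib]
      refine (Finset.sum_le_card_nsmul _ _ _ fun z _ =>
        pairPotential_sub_le (w := w) (G := G) (H := H₀) (H' := H) hm0 hW0 z).trans (le_of_eq ?_)
      rw [nsmul_eq_mul, Finset.card_product]
      push_cast; ring
    refine le_of_mul_le_mul_left ?_ hpos
    nlinarith

end Completion

/-! ### The number of centers -/

section Sampling

open MeasureTheory

variable {V : Type*} {k : ℕ}

lemma mem_centers_iff {ω : Coins V k} {i : ℕ} {v : V} :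
    v ∈ centers ω i ↔ ∀ j < i, ∀ h : j < k - 1, ω (⟨j, h⟩, v) = true := by
  induction i with
  | zero => simp [centers]
  | succ i ih =>
    simp only [centers, Set.mem_ofPred_eq, ih, Nat.lt_succ_iff_lt_or_eq]
    constructor
    · rintro ⟨h1, h2⟩ j (hj | rfl)
      exacts [h1 j hj, h2]
    · exact fun h => ⟨fun j hj => h j (Or.inl hj), h i (Or.inr rfl)⟩

/-- The event fixes the m · |T| coins of the first m rounds at T and leaves the others free: it is a
box for the product measure. -/
lemma coinMeasure_subset_centers [Fintype V] (p : unitInterval) {m : ℕ} (hm : m ≤ k - 1)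
    (T : Finset V) :
    coinMeasure V k p {ω | ∀ v ∈ T, v ∈ centers ω m} = ENNReal.ofReal ((p : ℝ) ^ (m * T.card)) := by
  classical
  have hset : {ω : Coins V k | ∀ v ∈ T, v ∈ centers ω m} = Set.univ.pi
      (fun x : Fin (k - 1) × V => if (x.1 : ℕ) < m ∧ x.2 ∈ T then {true} else Set.univ) := by
    ext ω
    simp only [Set.mem_ofPred_eq, mem_centers_iff, Set.mem_univ_pi]
    constructor
    · rintro h ⟨i, v⟩
      split_ifs with hx
      · exact h v hx.2 i hx.1 i.2
      · trivial
    · intro h v hv j hj hjk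
      simpa [hj, hv] using h (⟨j, hjk⟩, v)
  have hcard : (Finset.univ.filter fun x : Fin (k - 1) × V => (x.1 : ℕ) < m ∧ x.2 ∈ T).card =
      m * T.card := by
    have h1 : (Finset.univ.filter fun x : Fin (k - 1) × V => (x.1 : ℕ) < m ∧ x.2 ∈ T) =
        (Finset.univ.filter fun i : Fin (k - 1) => (i : ℕ) < m) ×ˢ T := by
      ext x; simp
    rw [h1, Finset.card_product, Fin.card_filter_val_lt, min_eq_right hm]
  have hp : ProbabilityTheory.bernoulliMeasure true false p {true} = ENNReal.ofReal p := by
    rw [ProbabilityTheory.bernoulliMeasure_apply p (MeasurableSet.singleton _)]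
    simp [ENNReal.ofReal, Real.toNNReal_of_nonneg p.2.1]
    rfl
  rw [hset, coinMeasure, Measure.pi_pi]
  have h2 : ∀ x : Fin (k - 1) × V, ProbabilityTheory.bernoulliMeasure true false p
      (if (x.1 : ℕ) < m ∧ x.2 ∈ T then {true} else Set.univ) =
      if (x.1 : ℕ) < m ∧ x.2 ∈ T then ENNReal.ofReal p else 1 := by
    intro x
    split_ifs
    · exact hp
    · exact measure_univ
  rw [Finset.prod_congr rfl fun x _ => h2 x, Finset.prod_ite, Finset.prod_const,
    Finset.prod_const_one, mul_one, hcard, ENNReal.ofReal_pow p.2.1]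

/-- The term of order r in the exponential series of e·x is at most its sum; the factor e^r then
moves to the other side. -/
lemma pow_div_factorial_le_exp_sub {x : ℝ} (hx : 0 ≤ x) (r : ℕ) :
    x ^ r / r.factorial ≤ Real.exp (Real.exp 1 * x - r) := by
  have h1 := Real.pow_div_factorial_le_exp (Real.exp 1 * x) (by positivity) r
  have h2 : Real.exp 1 ^ r = Real.exp r := by rw [← Real.exp_nat_mul, mul_one]
  rw [Real.exp_sub, le_div_iff₀ (Real.exp_pos _), ← h2]
  refine le_trans (le_of_eq ?_) h1
  rw [mul_pow]
  ring

open Classical in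
/-- The number of level-`m` centers exceeds its expectation by more than a constant factor and a
logarithmic term only with small probability. -/
lemma coinMeasure_card_centers_le [Fintype V] (p : unitInterval) {m : ℕ} (hm : m ≤ k - 1)
    {t : ℝ} :
    coinMeasure V k p {ω | Real.exp 1 * (Fintype.card V * (p : ℝ) ^ m) + t ≤
      ((centers ω m).toFinset.card : ℝ)} ≤ ENNReal.ofReal (Real.exp (-t)) := by
  set x : ℝ := Fintype.card V * (p : ℝ) ^ m with hx
  have hp0 : (0 : ℝ) ≤ p := p.2.1
  have hx0 : 0 ≤ x := by positivity
  -- Union bound over all r-element sets of potential centers, with r the least size that the event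
  -- forces.
  set r := ⌈Real.exp 1 * x + t⌉₊ with hr
  have hsub : {ω : Coins V k | Real.exp 1 * x + t ≤ ((centers ω m).toFinset.card : ℝ)} ⊆
      ⋃ T ∈ Finset.powersetCard r (Finset.univ : Finset V), {ω | ∀ v ∈ T, v ∈ centers ω m} := by
    intro ω hω
    rw [Set.mem_ofPred_eq] at hω
    obtain ⟨T, hT, hTr⟩ := Finset.exists_subset_card_eq (Nat.ceil_le.2 hω)
    simp only [Set.mem_iUnion, Finset.mem_powersetCard]
    exact ⟨T, ⟨Finset.subset_univ _, hTr⟩, fun v hv => by simpa using hT hv⟩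
  refine (measure_mono hsub).trans ((measure_biUnion_finset_le _ _).trans ?_)
  have hT : ∀ T ∈ Finset.powersetCard r (Finset.univ : Finset V),
      coinMeasure V k p {ω | ∀ v ∈ T, v ∈ centers ω m} = ENNReal.ofReal ((p : ℝ) ^ (m * r)) := by
    intro T hT
    rw [coinMeasure_subset_centers p hm, (Finset.mem_powersetCard.1 hT).2]
  rw [Finset.sum_congr rfl hT, Finset.sum_const, Finset.card_powersetCard, Finset.card_univ,
    nsmul_eq_mul, ← ENNReal.ofReal_natCast, ← ENNReal.ofReal_mul (Nat.cast_nonneg _)]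
  refine ENNReal.ofReal_le_ofReal ?_
  calc ((Fintype.card V).choose r : ℝ) * (p : ℝ) ^ (m * r)
      ≤ (Fintype.card V : ℝ) ^ r / r.factorial * (p : ℝ) ^ (m * r) := by
        gcongr
        exact Nat.choose_le_pow_div r _
    _ = x ^ r / r.factorial := by rw [hx, mul_pow, ← pow_mul]; ring
    _ ≤ Real.exp (Real.exp 1 * x - r) := pow_div_factorial_le_exp_sub hx0 r
    _ ≤ Real.exp (-t) := by
        refine Real.exp_le_exp.2 ?_
        linarith [Nat.le_ceil (Real.exp 1 * x + t)]

end Sampling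

/-! ### The final count -/

/-- With k = 2m + 1 and θ = 2m/k, the power p^(2m) is (p^k)^θ ≤ b · n^(−θ), and 2 − θ = 1 + 1/k. -/
lemma sq_mul_pow_le {n m : ℕ} (hn : 1 ≤ n) {p b : ℝ} (hp : 0 ≤ p) (hb : 1 ≤ b)
    (h : p ^ (2 * m + 1) ≤ b / n) :
    ((n : ℝ) * p ^ m) ^ 2 ≤ b * (n : ℝ) ^ (1 + 1 / ((2 * m + 1 : ℕ) : ℝ)) := by
  have hn0 : (0 : ℝ) < n := by exact_mod_cast hn
  set k : ℝ := ((2 * m + 1 : ℕ) : ℝ) with hk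
  have hk0 : 0 < k := by positivity
  have hkm : k = 2 * m + 1 := by simp [hk]
  set θ : ℝ := 2 * m / k with hθ
  have hθ0 : 0 ≤ θ := by positivity
  have hθ1 : θ ≤ 1 := by rw [hθ, div_le_one hk0]; linarith
  have h1 : p ^ (2 * m) = (p ^ (2 * m + 1)) ^ θ := by
    rw [← Real.rpow_natCast p (2 * m + 1), ← Real.rpow_mul hp, ← hk, hθ, mul_div_cancel₀ _ hk0.ne',
      ← Real.rpow_natCast]
    push_cast; rfl
  have h2 : p ^ (2 * m) ≤ b * (n : ℝ) ^ (-θ) := by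
    rw [h1]
    calc (p ^ (2 * m + 1)) ^ θ ≤ (b / n) ^ θ := Real.rpow_le_rpow (by positivity) h hθ0
      _ = b ^ θ * (n : ℝ) ^ (-θ) := by
          rw [Real.div_rpow (by linarith) hn0.le, Real.rpow_neg hn0.le, div_eq_mul_inv]
      _ ≤ b * (n : ℝ) ^ (-θ) := by
          gcongr
          exact Real.rpow_le_self_of_one_le hb hθ1
  have h3 : (1 : ℝ) + 1 / k = 2 + -θ := by
    rw [hθ]; field_simp; linarith
  rw [h3, Real.rpow_add hn0, mul_pow, ← pow_mul, mul_comm m 2]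
  have h4 : (n : ℝ) ^ (2 : ℝ) = (n : ℝ) ^ 2 := by norm_cast
  rw [h4]
  nlinarith [mul_le_mul_of_nonneg_left h2 (sq_nonneg (n : ℝ))]

end WeightedSpanner

theorem theorem2 (K A : ℝ) (a d : ℕ) :
    ∃ (C : ℝ) (c : ℕ),
      ∀ (V : Type*) [Fintype V] (n k : ℕ) (p : unitInterval)
        (G : SimpleGraph V) (w : Sym2 V → ℝ≥0),
        Fintype.card V = n → 2 ≤ n → Odd k → (k : ℝ) ≤ K * Real.log n →
        (p : ℝ) ^ k ≤ A * Real.log n ^ a / n →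
        (∀ e ∈ G.edgeSet, 0 < w e) →
        coinMeasure V k p
          {ω | ¬ ∀ H₀ H : SimpleGraph V,
            IsBaswanaSen w G k (centers ω) H₀ →
            CompletionReaches w G (k : ℝ≥0) ((k - 1 : ℕ) : ℝ≥0) H₀ H →
            (((H.edgeSet \ H₀.edgeSet).ncard : ℕ) : ℝ) ≤
              C * Real.log n ^ c * (n : ℝ) ^ (1 + 1 / (k : ℝ))}
          ≤ ENNReal.ofReal (1 / (n : ℝ) ^ d) := by
  classical
  -- The exponent collects a from the bound on p^k, 2 from the square of the deviation d · log n,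
  -- and 1 from k. The number 72 is 18 · 2², since 2 log n ≥ 1 is used to raise all powers of log n
  -- to a common one.
  refine ⟨49 * |K| * (72 * (|A| + 1) + 2 * d ^ 2) * 2 ^ a, a + 3, ?_⟩
  intro V _ n k p G w hcard hn hk hkK hpk hw
  obtain ⟨m, rfl⟩ := hk
  set l := Real.log n with hl
  have hn0 : (0 : ℝ) < n := by positivity
  have hl2 : 1 ≤ 2 * l := by
    have h1 : Real.log 2 ≤ l := Real.log_le_log (by norm_num) (by exact_mod_cast hn)
    linarith [Real.log_two_gt_d9]
  have hl0 : 0 < l := by linarith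
  have hexp : Real.exp (-(d * l)) = 1 / (n : ℝ) ^ d := by
    rw [Real.exp_neg, Real.exp_nat_mul, hl, Real.exp_log hn0, one_div]
  rw [← hexp]
  refine (MeasureTheory.measure_mono fun ω hω => ?_).trans
    (coinMeasure_card_centers_le p (m := m) (by omega))
  by_contra hlt
  rw [Set.mem_ofPred_eq] at hω hlt
  refine hω fun H₀ H hBS hreach => ?_
  obtain ⟨ctr, hctr⟩ := hBS.isClusteredSpanner rfl
  have hctr' : IsClusteredSpanner w G m ((centers ω m).toFinset : Finset V) ctr H₀ := by
    rwa [Set.coe_toFinset]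
  refine (hreach.ncard_le hw hctr').trans ?_
  set s : ℝ := ((centers ω m).toFinset.card : ℝ) with hs
  have hs0 : 0 ≤ s := Nat.cast_nonneg _
  set N : ℝ := (n : ℝ) ^ (1 + 1 / ((2 * m + 1 : ℕ) : ℝ)) with hN
  have hN1 : 1 ≤ N := Real.one_le_rpow (by exact_mod_cast (by omega : 1 ≤ n)) (by positivity)
  have hla : 1 ≤ (2 * l) ^ a := one_le_pow₀ hl2
  set b : ℝ := (|A| + 1) * (2 * l) ^ a with hb
  have hb1 : 1 ≤ b := by nlinarith [abs_nonneg A]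
  have hbp : (p : ℝ) ^ (2 * m + 1) ≤ b / n := by
    refine hpk.trans ?_
    gcongr
    calc A * l ^ a ≤ (|A| + 1) * l ^ a := by gcongr; linarith [le_abs_self A]
      _ ≤ b := by rw [hb]; gcongr; linarith
  have hx := sq_mul_pow_le (m := m) (by omega : 1 ≤ n) p.2.1 hb1 hbp
  rw [← hN] at hx
  set x : ℝ := (n : ℝ) * (p : ℝ) ^ m with hxdef
  have hx0 : 0 ≤ x := mul_nonneg hn0.le (pow_nonneg p.2.1 _)
  have hs1 : s ≤ 3 * x + d * l := by
    rw [hcard, ← hxdef, not_le] at hlt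
    nlinarith [Real.exp_one_lt_d9]
  have hs2 : s ^ 2 ≤ 18 * x ^ 2 + 2 * (d * l) ^ 2 := by
    have h1 : s ^ 2 ≤ (3 * x + d * l) ^ 2 := by gcongr
    nlinarith [sq_nonneg (3 * x - d * l)]
  have hs3 : s ^ 2 ≤ (18 * b + 2 * (d * l) ^ 2) * N := by
    have h1 : 2 * (d * l) ^ 2 * 1 ≤ 2 * (d * l) ^ 2 * N := by gcongr
    linarith
  -- Here 56m + 49 ≤ 49(2m + 1) = 49k.
  have hm : (7 : ℝ) * (8 * m + 7) ≤ 49 * |K| * l := by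
    have h1 : K * l ≤ |K| * l := by gcongr; exact le_abs_self K
    push_cast at hkK
    have h2 : (0 : ℝ) ≤ m := Nat.cast_nonneg m
    linarith
  have hb2 : 18 * b + 2 * (d * l) ^ 2 ≤ (72 * (|A| + 1) + 2 * d ^ 2) * 2 ^ a * l ^ (a + 2) := by
    have h1 : b * 1 ≤ b * (2 * l) ^ 2 := by
      gcongr
      exact one_le_pow₀ hl2
    have h2 : 2 * (d * l) ^ 2 * 1 ≤ 2 * (d * l) ^ 2 * (2 * l) ^ a := by gcongr
    calc 18 * b + 2 * (d * l) ^ 2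
        ≤ 18 * (b * (2 * l) ^ 2) + 2 * (d * l) ^ 2 * (2 * l) ^ a := by linarith
      _ = _ := by rw [hb, mul_pow 2 l a]; ring
  calc 7 * (8 * (m : ℝ) + 7) * s ^ 2
      ≤ (49 * |K| * l) * ((72 * (|A| + 1) + 2 * d ^ 2) * 2 ^ a * l ^ (a + 2) * N) := by
        have h1 : (18 * b + 2 * (d * l) ^ 2) * N ≤
            (72 * (|A| + 1) + 2 * d ^ 2) * 2 ^ a * l ^ (a + 2) * N := by gcongr
        gcongr
        exact hs3.trans h1
    _ = _ := by ring
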